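/- Let $\Bbbk$ be an algebraically closed field of characteristic different from $2$, and let ${\mathcal{KP}}$ be the Kac--Paljutkin algebra: the eight-dimensional Hopf algebra generated by $x,y,z$ with relations $x^2=y^2=1$, $xy=yx$, $zx=yz$, $zy=xz$, $z^2=\tfrac12(1+x+y-xy)$, where $x,y$ are grouplike, $\Delta(z)=\tfrac12(1\otimes 1+1\otimes x+y\otimes 1-y\otimes x)(z\otimes z)$ and $\varepsilon(z)=1$. Let $K=\{1,x,y,xy\}$. A left ${\mathcal{KP}}$-comodule algebra is an algebra $A$ with a coassociative and counital algebra map $\lambda:A\to{\mathcal{KP}}\otimes A$. It is called AM-exact if it is finite-dimensional, right ${\mathcal{KP}}$-simple (that is, $A\neq 0$ and the only right ideals $J$ of $A$ with $\lambda(J)\subseteq{\mathcal{KP}}\otimes J$ are $0$ and $A$), and has trivial coinvariants, $\{a\in A:\lambda(a)=1\otimes a\}=\Bbbk 1$. A coideal subalgebra of ${\mathcal{KP}}$ is a subalgebra $B\subseteq{\mathcal{KP}}$ with $\Delta(B)\subseteq{\mathcal{KP}}\otimes B$, regarded as a comodule algebra through $\Delta$. Let $\Bbbk^\psi[K]$ be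 the twisted group algebra with basis $\{e_g\}_{g\in K}$, product $e_ge_h=\psi(g,h)e_{gh}$, where $\psi(x^iy^j,x^ky^\ell)=(-1)^{jk}$, and coaction $\lambda(e_g)=g\otimes e_g$. Theorem. Every AM-exact left ${\mathcal{KP}}$-comodule algebra is isomorphic, as a ${\mathcal{KP}}$-comodule algebra, to a coideal subalgebra of ${\mathcal{KP}}$ or to $\Bbbk^\psi[K]$. -/

import Mathlib

open scoped TensorProduct

/-- The Klein four-group `{1, x, y, xy}`. -/
abbrev Klein : Type := Multiplicative (ZMod 2) × Multiplicative (ZMod 2)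

namespace Klein
def x : Klein := (Multiplicative.ofAdd 1, 1)
def y : Klein := (1, Multiplicative.ofAdd 1)

def swap : Klein →* Klein := (MulEquiv.prodComm : Klein ≃* Klein).toMonoidHom

def toMon {M : Type*} [Monoid M] (X Y : M) (hX : X * X = 1) (hY : Y * Y = 1)
    (hXY : X * Y = Y * X) : Klein →* M where
  toFun g := X ^ (g.1.toAdd.val) * Y ^ (g.2.toAdd.val)
  map_one' := by simp
  map_mul' := by
    have e1 : ∀ a b : Multiplicative (ZMod 2), X ^ ((a * b).toAdd.val) =
        X ^ (a.toAdd.val) * X ^ (b.toAdd.val) := by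
      intro a b
      rw [← pow_add, toAdd_mul, ZMod.val_add]
      conv_rhs => rw [← Nat.mod_add_div (a.toAdd.val + b.toAdd.val) 2, pow_add, pow_mul]
      simp [pow_two, hX]
    have e2 : ∀ a b : Multiplicative (ZMod 2), Y ^ ((a * b).toAdd.val) =
        Y ^ (a.toAdd.val) * Y ^ (b.toAdd.val) := by
      intro a b
      rw [← pow_add, toAdd_mul, ZMod.val_add]
      conv_rhs => rw [← Nat.mod_add_div (a.toAdd.val + b.toAdd.val) 2, pow_add, pow_mul]
      simp [pow_two, hY]
    intro g h
    have c : Commute X Y := hXY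
    simp only [Prod.fst_mul, Prod.snd_mul, e1, e2]
    rw [mul_assoc, mul_assoc, ← mul_assoc (Y ^ _), (c.pow_pow _ _).eq.symm]
    simp only [mul_assoc]

end Klein

/-- The group algebra `k[K]` of the Klein four-group. -/
abbrev KleinAlg (k : Type*) [Field k] : Type _ := MonoidAlgebra k Klein

namespace KleinAlg
variable (k : Type*) [Field k]

noncomputable def x : KleinAlg k := MonoidAlgebra.of k Klein Klein.x
noncomputable def y : KleinAlg k := MonoidAlgebra.of k Klein Klein.y

/-- The automorphism of `k[K]` that exchanges `x` and `y`. -/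
noncomputable def swap : KleinAlg k →ₐ[k] KleinAlg k := MonoidAlgebra.mapDomainAlgHom k k Klein.swap

/-- The element `J = (1 + x + y - xy) / 2`, which is going to be `z²`. -/
noncomputable def J : KleinAlg k := (2 : k)⁻¹ • (1 + x k + y k - x k * y k)

theorem x_mul_x : x k * x k = 1 := by
  rw [x, ← map_mul, ← map_one (MonoidAlgebra.of k Klein)]; congr 1
theorem y_mul_y : y k * y k = 1 := by
  rw [y, ← map_mul, ← map_one (MonoidAlgebra.of k Klein)]; congr 1
theorem swap_x : swap k (x k) = y k := by
  simp [swap, x, y, Klein.swap, Klein.x, Klein.y]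
theorem swap_y : swap k (y k) = x k := by
  simp [swap, x, y, Klein.swap, Klein.x, Klein.y]
theorem swap_swap (a : KleinAlg k) : swap k (swap k a) = a := by
  have : (swap k).comp (swap k) = AlgHom.id k _ := by
    apply MonoidAlgebra.algHom_ext
    · intro m
      simp [swap, Klein.swap]
    · exact Subsingleton.elim _ _
  exact DFunLike.congr_fun this a
theorem swap_J : swap k (J k) = J k := by
  rw [J, map_smul, map_sub, map_mul, map_add, map_add, map_one, swap_x, swap_y,
    mul_comm (y k), add_right_comm]

theorem of_eq (g : Klein) : MonoidAlgebra.of k Klein g =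
    x k ^ (g.1.toAdd.val) * y k ^ (g.2.toAdd.val) := by
  rw [x, y, ← map_pow, ← map_pow, ← map_mul]
  congr 1
  revert g
  decide

variable {k} in
/-- Algebra maps out of `k[K]` are given by two commuting elements of square one. -/
noncomputable def lift {B : Type*} [Ring B] [Algebra k B] (X Y : B) (hX : X * X = 1)
    (hY : Y * Y = 1) (hXY : X * Y = Y * X) : KleinAlg k →ₐ[k] B :=
  MonoidAlgebra.lift k B Klein (Klein.toMon X Y hX hY hXY)

section
variable {k} {B : Type*} [Ring B] [Algebra k B]

theorem lift_x (X Y : B) (hX : X * X = 1) (hY : Y * Y = 1) (hXY : X * Y = Y * X) :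
    lift (k := k) X Y hX hY hXY (x k) = X := by
  rw [lift, x, MonoidAlgebra.lift_of]
  simp [Klein.toMon, Klein.x, ZMod.val_one]
theorem lift_y (X Y : B) (hX : X * X = 1) (hY : Y * Y = 1) (hXY : X * Y = Y * X) :
    lift (k := k) X Y hX hY hXY (y k) = Y := by
  rw [lift, y, MonoidAlgebra.lift_of]
  simp [Klein.toMon, Klein.y, ZMod.val_one]

theorem algHom_ext {f g : KleinAlg k →ₐ[k] B} (hx : f (x k) = g (x k)) (hy : f (y k) = g (y k)) :
    f = g := by
  apply MonoidAlgebra.algHom_ext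
  · intro m
    have := of_eq k m
    rw [MonoidAlgebra.of_apply] at this
    rw [this, map_mul, map_mul, map_pow, map_pow, map_pow, map_pow, hx, hy]
  · exact Subsingleton.elim _ _
end
end KleinAlg

/-- The Kac-Paljutkin algebra: the eight-dimensional algebra `k[K] ⊕ k[K] z` where
`z a = swap a z` for `a ∈ k[K]` and `z² = (1 + x + y - xy) / 2`.
The pair `⟨a, b⟩` stands for `a + b z`. -/
@[ext] structure KP (k : Type*) [Field k] where
  fst : KleinAlg k
  snd : KleinAlg k

namespace KP
section algebra
variable {k : Type*} [Field k]

/-- `KP` as a vector space. -/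
def equivProd : KP k ≃ KleinAlg k × KleinAlg k where
  toFun p := (p.fst, p.snd)
  invFun q := ⟨q.1, q.2⟩

noncomputable instance instAddCommGroup : AddCommGroup (KP k) := equivProd.addCommGroup
noncomputable instance instModule : Module k (KP k) := equivProd.module k

/-- `(a + b z) (c + d z) = (a c + b (swap d) J) + (a d + b (swap c)) z`. -/
noncomputable instance instMul : Mul (KP k) where
  mul p q := ⟨p.fst * q.fst + p.snd * KleinAlg.swap k q.snd * KleinAlg.J k,
    p.fst * q.snd + p.snd * KleinAlg.swap k q.fst⟩
noncomputable instance instOne : One (KP k) where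
  one := ⟨1, 0⟩

theorem mul_fst (p q : KP k) :
  (p * q).fst = p.fst * q.fst + p.snd * KleinAlg.swap k q.snd * KleinAlg.J k := rfl
theorem mul_snd (p q : KP k) : (p * q).snd = p.fst * q.snd + p.snd * KleinAlg.swap k q.fst := rfl
theorem one_fst : (1 : KP k).fst = 1 := rfl
theorem one_snd : (1 : KP k).snd = 0 := rfl
theorem add_fst (p q : KP k) : (p + q).fst = p.fst + q.fst := rfl
theorem add_snd (p q : KP k) : (p + q).snd = p.snd + q.snd := rfl
theorem zero_fst : (0 : KP k).fst = 0 := rfl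
theorem zero_snd : (0 : KP k).snd = 0 := rfl
theorem smul_fst (r : k) (p : KP k) : (r • p).fst = r • p.fst := rfl
theorem smul_snd (r : k) (p : KP k) : (r • p).snd = r • p.snd := rfl

noncomputable instance instRing : Ring (KP k) where
  __ := instAddCommGroup (k := k)
  __ := instMul (k := k)
  __ := instOne (k := k)
  left_distrib p q r := by
    apply KP.ext <;> simp only [mul_fst, mul_snd, add_fst, add_snd, map_add] <;> ring
  right_distrib p q r := by
    apply KP.ext <;> simp only [mul_fst, mul_snd, add_fst, add_snd] <;> ring
  zero_mul p := by
    apply KP.ext <;> simp [mul_fst, mul_snd, zero_fst, zero_snd]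
  mul_zero p := by
    apply KP.ext <;> simp [mul_fst, mul_snd, zero_fst, zero_snd]
  mul_assoc p q r := by
    apply KP.ext <;> simp only [mul_fst, mul_snd, map_add, map_mul, KleinAlg.swap_swap,
      KleinAlg.swap_J] <;> ring
  one_mul p := by
    apply KP.ext <;> simp [mul_fst, mul_snd, one_fst, one_snd]
  mul_one p := by
    apply KP.ext <;> simp [mul_fst, mul_snd, one_fst, one_snd]

noncomputable instance instAlgebra : Algebra k (KP k) := Algebra.ofModule
  (fun r p q => by
    apply KP.ext <;> simp [mul_fst, mul_snd, smul_fst, smul_snd])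
  (fun r p q => by
    apply KP.ext <;> simp [mul_fst, mul_snd, smul_fst, smul_snd])

/-- The inclusion of `k[K]`. -/
noncomputable def incl : KleinAlg k →ₐ[k] KP k := AlgHom.ofLinearMap
  { toFun := fun a => (⟨a, 0⟩ : KP k)
    map_add' := fun a b => by apply KP.ext <;> simp [add_fst, add_snd]
    map_smul' := fun r a => by apply KP.ext <;> simp [smul_fst, smul_snd] } rfl
  (fun a b => by
    apply KP.ext <;> simp [mul_fst, mul_snd])

theorem incl_fst (a : KleinAlg k) : (incl a).fst = a := rfl
theorem incl_snd (a : KleinAlg k) : (incl a).snd = 0 := rfl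

variable (k) in
noncomputable def x : KP k := incl (KleinAlg.x k)
variable (k) in
noncomputable def y : KP k := incl (KleinAlg.y k)
variable (k) in
noncomputable def z : KP k := ⟨0, 1⟩

theorem z_fst : (z k).fst = 0 := rfl
theorem z_snd : (z k).snd = 1 := rfl

theorem eq_add (p : KP k) : p = incl p.fst + incl p.snd * z k := by
  apply KP.ext <;> simp [mul_fst, mul_snd, add_fst, add_snd, incl_fst, incl_snd, z_fst, z_snd]

theorem z_mul_incl (a : KleinAlg k) : z k * incl a = incl (KleinAlg.swap k a) * z k := by
  apply KP.ext <;> simp [mul_fst, mul_snd, incl_fst, incl_snd, z_fst, z_snd]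

theorem z_mul_z' : z k * z k = incl (KleinAlg.J k) := by
  apply KP.ext <;> simp [mul_fst, mul_snd, incl_fst, incl_snd, z_fst, z_snd]

theorem x_mul_x : x k * x k = 1 := by rw [x, ← map_mul, KleinAlg.x_mul_x, map_one]
theorem y_mul_y : y k * y k = 1 := by rw [y, ← map_mul, KleinAlg.y_mul_y, map_one]
theorem x_mul_y : x k * y k = y k * x k := by rw [x, y, ← map_mul, ← map_mul, mul_comm]
theorem z_mul_x : z k * x k = y k * z k := by rw [x, y, z_mul_incl, KleinAlg.swap_x]
theorem z_mul_y : z k * y k = x k * z k := by rw [x, y, z_mul_incl, KleinAlg.swap_y]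
theorem z_mul_z : z k * z k = (2 : k)⁻¹ • (1 + x k + y k - x k * y k) := by
  rw [z_mul_z', KleinAlg.J, x, y]; simp

section lift
variable {B : Type*} [Ring B] [Algebra k B]

/-- The universal property of the presentation of `KP` by `x, y, z`. -/
noncomputable def lift (X Y Z : B) (hX : X * X = 1) (hY : Y * Y = 1) (hXY : X * Y = Y * X)
    (hZX : Z * X = Y * Z) (hZY : Z * Y = X * Z)
    (hZ : Z * Z = (2 : k)⁻¹ • (1 + X + Y - X * Y)) : KP k →ₐ[k] B :=
  AlgHom.ofLinearMap
    { toFun := fun p => KleinAlg.lift (k := k) X Y hX hY hXY p.fst +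
        KleinAlg.lift (k := k) X Y hX hY hXY p.snd * Z
      map_add' := fun p q => by
        rw [add_fst, add_snd, map_add, map_add, add_mul]; abel
      map_smul' := fun r p => by
        rw [smul_fst, smul_snd, map_smul, map_smul, smul_mul_assoc, RingHom.id_apply, smul_add] }
    (by
      change KleinAlg.lift (k := k) X Y hX hY hXY 1 + KleinAlg.lift (k := k) X Y hX hY hXY 0 * Z = 1
      simp)
    (by
      intro p q
      have key : ∀ a, Z * KleinAlg.lift (k := k) X Y hX hY hXY a =
          KleinAlg.lift (k := k) X Y hX hY hXY (KleinAlg.swap k a) * Z := by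
        intro a
        induction a using MonoidAlgebra.induction_on with
        | of g =>
          have e1 : ∀ n : ℕ, Z * X ^ n = Y ^ n * Z := fun n =>
            (SemiconjBy.pow_right (a := Z) (x := X) (y := Y) hZX n)
          have e2 : ∀ n : ℕ, Z * Y ^ n = X ^ n * Z := fun n =>
            (SemiconjBy.pow_right (a := Z) (x := Y) (y := X) hZY n)
          have c : Commute X Y := hXY
          rw [KleinAlg.of_eq]
          simp only [map_mul, map_pow, KleinAlg.swap_x, KleinAlg.swap_y, KleinAlg.lift_x,
            KleinAlg.lift_y]
          rw [← mul_assoc, e1, mul_assoc, e2, mul_assoc]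
        | add a b ha hb => rw [map_add, map_add, map_add, mul_add, add_mul, ha, hb]
        | smul r a ha => rw [map_smul, map_smul, map_smul, mul_smul_comm, smul_mul_assoc, ha]
      have hJ : KleinAlg.lift (k := k) X Y hX hY hXY (KleinAlg.J k) = Z * Z := by
        rw [hZ, KleinAlg.J]; simp [KleinAlg.lift_x, KleinAlg.lift_y]
      change KleinAlg.lift (k := k) X Y hX hY hXY (p * q).fst +
          KleinAlg.lift (k := k) X Y hX hY hXY (p * q).snd * Z =
        (KleinAlg.lift (k := k) X Y hX hY hXY p.fst + KleinAlg.lift (k := k) X Y hX hY hXY p.snd * Z) *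
        (KleinAlg.lift (k := k) X Y hX hY hXY q.fst + KleinAlg.lift (k := k) X Y hX hY hXY q.snd * Z)
      have k1 := key q.fst
      have k2 := key (KleinAlg.swap k q.snd)
      rw [KleinAlg.swap_swap] at k2
      have k3 : KleinAlg.lift (k := k) X Y hX hY hXY (KleinAlg.swap k q.snd) * (Z * Z) =
          Z * KleinAlg.lift (k := k) X Y hX hY hXY q.snd * Z := by
        rw [key q.snd, mul_assoc]
      simp only [mul_fst, mul_snd, map_add, map_mul, hJ, add_mul, mul_add]
      rw [mul_assoc _ _ (Z * Z), k3]
      rw [mul_assoc _ (KleinAlg.lift X Y hX hY hXY (KleinAlg.swap k q.fst)) Z, ← k1]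
      simp only [mul_assoc]
      abel)

theorem lift_incl (X Y Z : B) (hX : X * X = 1) (hY : Y * Y = 1) (hXY : X * Y = Y * X)
    (hZX : Z * X = Y * Z) (hZY : Z * Y = X * Z)
    (hZ : Z * Z = (2 : k)⁻¹ • (1 + X + Y - X * Y)) (a : KleinAlg k) :
    lift X Y Z hX hY hXY hZX hZY hZ (incl a) = KleinAlg.lift (k := k) X Y hX hY hXY a := by
  change KleinAlg.lift (k := k) X Y hX hY hXY a + KleinAlg.lift (k := k) X Y hX hY hXY 0 * Z = _
  simp

theorem lift_x (X Y Z : B) (hX : X * X = 1) (hY : Y * Y = 1) (hXY : X * Y = Y * X)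
    (hZX : Z * X = Y * Z) (hZY : Z * Y = X * Z)
    (hZ : Z * Z = (2 : k)⁻¹ • (1 + X + Y - X * Y)) :
    lift X Y Z hX hY hXY hZX hZY hZ (x k) = X := by
  rw [x, lift_incl, KleinAlg.lift_x]

theorem lift_y (X Y Z : B) (hX : X * X = 1) (hY : Y * Y = 1) (hXY : X * Y = Y * X)
    (hZX : Z * X = Y * Z) (hZY : Z * Y = X * Z)
    (hZ : Z * Z = (2 : k)⁻¹ • (1 + X + Y - X * Y)) :
    lift X Y Z hX hY hXY hZX hZY hZ (y k) = Y := by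
  rw [y, lift_incl, KleinAlg.lift_y]

theorem lift_z (X Y Z : B) (hX : X * X = 1) (hY : Y * Y = 1) (hXY : X * Y = Y * X)
    (hZX : Z * X = Y * Z) (hZY : Z * Y = X * Z)
    (hZ : Z * Z = (2 : k)⁻¹ • (1 + X + Y - X * Y)) :
    lift X Y Z hX hY hXY hZX hZY hZ (z k) = Z := by
  change KleinAlg.lift (k := k) X Y hX hY hXY 0 + KleinAlg.lift (k := k) X Y hX hY hXY 1 * Z = _
  simp

theorem algHom_ext {f g : KP k →ₐ[k] B} (hx : f (x k) = g (x k)) (hy : f (y k) = g (y k))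
    (hz : f (z k) = g (z k)) : f = g := by
  have h : f.comp incl = g.comp incl := KleinAlg.algHom_ext hx hy
  ext p
  have h1 : ∀ a, f (incl a) = g (incl a) := fun a => DFunLike.congr_fun h a
  rw [eq_add p, map_add, map_add, map_mul, map_mul, h1, h1, hz]
end lift
end algebra
end KP

namespace KP
section hopf
variable (k : Type*) [Field k]

/-- `Δ(z) = (1 ⊗ 1 + 1 ⊗ x + y ⊗ 1 - y ⊗ x) (z ⊗ z) / 2`. -/
noncomputable def comulZ : KP k ⊗[k] KP k :=
  (2 : k)⁻¹ • ((1 ⊗ₜ 1 + 1 ⊗ₜ x k + y k ⊗ₜ 1 - y k ⊗ₜ x k) * (z k ⊗ₜ z k))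

/-- The inclusion of `k[K] ⊗ k[K]`. -/
noncomputable def incl₂ : KleinAlg k ⊗[k] KleinAlg k →ₐ[k] KP k ⊗[k] KP k :=
  Algebra.TensorProduct.map incl incl

noncomputable def swap₂ : KleinAlg k ⊗[k] KleinAlg k →ₐ[k] KleinAlg k ⊗[k] KleinAlg k :=
  Algebra.TensorProduct.map (KleinAlg.swap k) (KleinAlg.swap k)

theorem zz_mul_incl₂ (a : KleinAlg k ⊗[k] KleinAlg k) :
    (z k ⊗ₜ[k] z k) * incl₂ k a = incl₂ k (swap₂ k a) * (z k ⊗ₜ[k] z k) := by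
  induction a using TensorProduct.induction_on with
  | zero => simp
  | tmul a b => simp [incl₂, swap₂, z_mul_incl]
  | add a b ha hb => rw [map_add, map_add, map_add, mul_add, add_mul, ha, hb]

noncomputable def comulCoeff : KleinAlg k ⊗[k] KleinAlg k :=
  (2 : k)⁻¹ • (1 ⊗ₜ 1 + 1 ⊗ₜ KleinAlg.x k + KleinAlg.y k ⊗ₜ 1 - KleinAlg.y k ⊗ₜ KleinAlg.x k)

theorem comulZ_eq : comulZ k = incl₂ k (comulCoeff k) * (z k ⊗ₜ z k) := by
  simp [comulZ, comulCoeff, incl₂, x, y, smul_mul_assoc, -Algebra.TensorProduct.tmul_mul_tmul]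

theorem comulCoeff_sq_aux {R : Type*} [CommRing R] (h x₁ x₂ y₁ y₂ : R) (hh : 2 * h = 1)
    (hx₁ : x₁ * x₁ = 1) (hx₂ : x₂ * x₂ = 1) (hy₁ : y₁ * y₁ = 1) (hy₂ : y₂ * y₂ = 1) :
    (h * (1 + x₂ + y₁ - y₁ * x₂)) * (h * (1 + y₂ + x₁ - x₁ * y₂)) *
      ((h * (1 + x₁ + y₁ - x₁ * y₁)) * (h * (1 + x₂ + y₂ - x₂ * y₂))) =
    h * (1 + x₁ * x₂ + y₁ * y₂ - x₁ * x₂ * (y₁ * y₂)) := by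
  grind

theorem comulCoeff_sq [NeZero (2 : k)] :
    comulCoeff k * swap₂ k (comulCoeff k) * (KleinAlg.J k ⊗ₜ KleinAlg.J k) =
      (2 : k)⁻¹ • (1 + KleinAlg.x k ⊗ₜ KleinAlg.x k + KleinAlg.y k ⊗ₜ KleinAlg.y k -
        (KleinAlg.x k ⊗ₜ KleinAlg.x k) * (KleinAlg.y k ⊗ₜ KleinAlg.y k)) := by
  have h2 : (2 : k) ≠ 0 := NeZero.ne 2
  have hh : 2 * algebraMap k (KleinAlg k ⊗[k] KleinAlg k) (2 : k)⁻¹ = 1 := by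
    have : (2 : KleinAlg k ⊗[k] KleinAlg k) = algebraMap k _ 2 :=
      (map_ofNat (algebraMap k (KleinAlg k ⊗[k] KleinAlg k)) 2).symm
    rw [this, ← map_mul, mul_inv_cancel₀ h2, map_one]
  have e := comulCoeff_sq_aux (R := KleinAlg k ⊗[k] KleinAlg k)
    (algebraMap k _ (2 : k)⁻¹) (KleinAlg.x k ⊗ₜ 1) (1 ⊗ₜ KleinAlg.x k)
    (KleinAlg.y k ⊗ₜ 1) (1 ⊗ₜ KleinAlg.y k) hh
    (by simp [KleinAlg.x_mul_x, Algebra.TensorProduct.one_def])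
    (by simp [KleinAlg.x_mul_x, Algebra.TensorProduct.one_def])
    (by simp [KleinAlg.y_mul_y, Algebra.TensorProduct.one_def])
    (by simp [KleinAlg.y_mul_y, Algebra.TensorProduct.one_def])
  simp only [← Algebra.smul_def] at e
  have e1 : comulCoeff k = (2 : k)⁻¹ • (1 + 1 ⊗ₜ KleinAlg.x k + KleinAlg.y k ⊗ₜ 1 -
      (KleinAlg.y k ⊗ₜ 1) * (1 ⊗ₜ KleinAlg.x k)) := by
    simp [comulCoeff, Algebra.TensorProduct.one_def]
  have e2 : swap₂ k (comulCoeff k) = (2 : k)⁻¹ • (1 + 1 ⊗ₜ KleinAlg.y k + KleinAlg.x k ⊗ₜ 1 -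
      (KleinAlg.x k ⊗ₜ 1) * (1 ⊗ₜ KleinAlg.y k)) := by
    simp [swap₂, comulCoeff, KleinAlg.swap_x, KleinAlg.swap_y, Algebra.TensorProduct.one_def]
  have e3 : (KleinAlg.J k ⊗ₜ[k] KleinAlg.J k) =
      ((2 : k)⁻¹ • (1 + (KleinAlg.x k ⊗ₜ[k] (1 : KleinAlg k)) + KleinAlg.y k ⊗ₜ 1 -
        (KleinAlg.x k ⊗ₜ 1) * (KleinAlg.y k ⊗ₜ 1))) *
      ((2 : k)⁻¹ • (1 + 1 ⊗ₜ KleinAlg.x k + 1 ⊗ₜ KleinAlg.y k -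
        (1 ⊗ₜ KleinAlg.x k) * (1 ⊗ₜ KleinAlg.y k))) := by
    have : (KleinAlg.J k ⊗ₜ[k] KleinAlg.J k) =
      (KleinAlg.J k ⊗ₜ[k] (1 : KleinAlg k)) * (1 ⊗ₜ[k] KleinAlg.J k) := by simp
    rw [this]
    congr 1
    · rw [KleinAlg.J, ← TensorProduct.smul_tmul']
      simp [TensorProduct.add_tmul, TensorProduct.sub_tmul, Algebra.TensorProduct.one_def]
    · simp [KleinAlg.J, TensorProduct.tmul_add, TensorProduct.tmul_sub,
        Algebra.TensorProduct.one_def]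
  rw [e2, e1, e3, e]
  simp

theorem xx_mul_xx : (x k ⊗ₜ[k] x k) * (x k ⊗ₜ[k] x k) = 1 := by
  simp [x_mul_x, Algebra.TensorProduct.one_def]
theorem yy_mul_yy : (y k ⊗ₜ[k] y k) * (y k ⊗ₜ[k] y k) = 1 := by
  simp [y_mul_y, Algebra.TensorProduct.one_def]
theorem xx_mul_yy : (x k ⊗ₜ[k] x k) * (y k ⊗ₜ[k] y k) = (y k ⊗ₜ[k] y k) * (x k ⊗ₜ[k] x k) := by
  simp [x_mul_y]
theorem comulZ_mul_xx : comulZ k * (x k ⊗ₜ[k] x k) = (y k ⊗ₜ[k] y k) * comulZ k := by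
  have h1 : (x k ⊗ₜ[k] x k) = incl₂ k (KleinAlg.x k ⊗ₜ KleinAlg.x k) := rfl
  have h2 : (y k ⊗ₜ[k] y k) = incl₂ k (KleinAlg.y k ⊗ₜ KleinAlg.y k) := rfl
  rw [h1, h2, comulZ_eq, mul_assoc, zz_mul_incl₂, ← mul_assoc, ← mul_assoc, ← map_mul,
    ← map_mul, mul_comm]
  simp [swap₂, KleinAlg.swap_x]
theorem comulZ_mul_yy : comulZ k * (y k ⊗ₜ[k] y k) = (x k ⊗ₜ[k] x k) * comulZ k := by
  have h1 : (x k ⊗ₜ[k] x k) = incl₂ k (KleinAlg.x k ⊗ₜ KleinAlg.x k) := rfl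
  have h2 : (y k ⊗ₜ[k] y k) = incl₂ k (KleinAlg.y k ⊗ₜ KleinAlg.y k) := rfl
  rw [h1, h2, comulZ_eq, mul_assoc, zz_mul_incl₂, ← mul_assoc, ← mul_assoc, ← map_mul,
    ← map_mul, mul_comm]
  simp [swap₂, KleinAlg.swap_y]
theorem comulZ_mul_comulZ [NeZero (2 : k)] : comulZ k * comulZ k =
    (2 : k)⁻¹ • (1 + (x k ⊗ₜ[k] x k) + (y k ⊗ₜ[k] y k) - (x k ⊗ₜ[k] x k) * (y k ⊗ₜ[k] y k)) := by
  have h3 : (z k ⊗ₜ[k] z k) * (z k ⊗ₜ[k] z k) = incl₂ k (KleinAlg.J k ⊗ₜ KleinAlg.J k) := by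
    simp [z_mul_z', incl₂]
  have h4 : comulZ k * comulZ k = incl₂ k (comulCoeff k * swap₂ k (comulCoeff k) *
      (KleinAlg.J k ⊗ₜ KleinAlg.J k)) := by
    rw [comulZ_eq, mul_assoc, ← mul_assoc (z k ⊗ₜ[k] z k), zz_mul_incl₂, mul_assoc, h3,
      map_mul, map_mul, mul_assoc]
  rw [h4, comulCoeff_sq]
  simp [incl₂, x, y]

/-- The comultiplication: `x` and `y` are grouplike, and `Δ(z)` is as above. -/
noncomputable def comulHom [NeZero (2 : k)] : KP k →ₐ[k] KP k ⊗[k] KP k :=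
  lift (x k ⊗ₜ x k) (y k ⊗ₜ y k) (comulZ k) (xx_mul_xx k) (yy_mul_yy k) (xx_mul_yy k)
    (comulZ_mul_xx k) (comulZ_mul_yy k) (comulZ_mul_comulZ k)

/-- The counit: `ε(x) = ε(y) = ε(z) = 1`. -/
noncomputable def counitHom [NeZero (2 : k)] : KP k →ₐ[k] k :=
  lift 1 1 1 (by simp) (by simp) (by simp) (by simp) (by simp)
    (by have h2 : (2 : k) ≠ 0 := NeZero.ne 2
        simp only [smul_eq_mul]; field_simp; ring)

theorem comulZ_expand : comulZ k = (2 : k)⁻¹ • (z k ⊗ₜ z k + z k ⊗ₜ (x k * z k) +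
    (y k * z k) ⊗ₜ z k - (y k * z k) ⊗ₜ (x k * z k)) := by
  simp [comulZ, add_mul, sub_mul]

theorem y_mul_y_mul (a : KP k) : y k * (y k * a) = a := by rw [← mul_assoc, y_mul_y, one_mul]
theorem x_mul_x_mul (a : KP k) : x k * (x k * a) = a := by rw [← mul_assoc, x_mul_x, one_mul]
theorem y_mul_x_mul (a : KP k) : y k * (x k * a) = x k * (y k * a) := by
  rw [← mul_assoc, ← mul_assoc, x_mul_y]

/-- The antipode: the linear anti-automorphism that fixes `x`, `y` and `z`. -/
noncomputable def antipodeLin : KP k →ₗ[k] KP k where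
  toFun p := ⟨p.fst, KleinAlg.swap k p.snd⟩
  map_add' p q := by apply KP.ext <;> simp [add_fst, add_snd]
  map_smul' r p := by apply KP.ext <;> simp [smul_fst, smul_snd]

theorem antipodeLin_incl (a : KleinAlg k) : antipodeLin k (incl a) = incl a := by
  apply KP.ext <;> simp [antipodeLin, incl_fst, incl_snd]
theorem antipodeLin_incl_mul_z (a : KleinAlg k) :
    antipodeLin k (incl a * z k) = incl (KleinAlg.swap k a) * z k := by
  apply KP.ext <;> simp [antipodeLin, incl_fst, incl_snd, mul_fst, mul_snd, z_fst, z_snd]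

theorem linearMap_ext {M : Type*} [AddCommGroup M] [Module k M] {f g : KP k →ₗ[k] M}
    (h1 : ∀ a ∈ ({1, x k, y k, x k * y k} : Set (KP k)), f a = g a)
    (h2 : ∀ a ∈ ({1, x k, y k, x k * y k} : Set (KP k)), f (a * z k) = g (a * z k)) : f = g := by
  have hm : ∀ m : Klein, incl (MonoidAlgebra.of k Klein m) ∈
      ({1, x k, y k, x k * y k} : Set (KP k)) := by
    intro m
    rw [KleinAlg.of_eq, map_mul, map_pow, map_pow]
    have : ∀ n : ZMod 2, n.val = 0 ∨ n.val = 1 := by decide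
    rcases this m.1.toAdd with h | h <;> rcases this m.2.toAdd with h' | h' <;>
      simp [h, h', x, y]
  have e1 : ∀ a : KleinAlg k, f (incl a) = g (incl a) := by
    intro a
    induction a using MonoidAlgebra.induction_on with
    | of m => exact h1 _ (hm m)
    | add a b ha hb => rw [map_add, map_add, map_add, ha, hb]
    | smul r a ha => rw [map_smul, map_smul, map_smul, ha]
  have e2 : ∀ a : KleinAlg k, f (incl a * z k) = g (incl a * z k) := by
    intro a
    induction a using MonoidAlgebra.induction_on with
    | of m => exact h2 _ (hm m)
    | add a b ha hb => rw [map_add, add_mul, map_add, map_add, ha, hb]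
    | smul r a ha => rw [map_smul, smul_mul_assoc, map_smul, map_smul, ha]
  ext p
  rw [eq_add p, map_add, map_add, e1, e2]

theorem antipodeLin_one : antipodeLin k 1 = 1 := by
  simpa using antipodeLin_incl k 1
theorem antipodeLin_x : antipodeLin k (x k) = x k := antipodeLin_incl k _
theorem antipodeLin_y : antipodeLin k (y k) = y k := antipodeLin_incl k _
theorem antipodeLin_xy : antipodeLin k (x k * y k) = x k * y k := by
  rw [x, y, ← map_mul, antipodeLin_incl]
theorem antipodeLin_z : antipodeLin k (z k) = z k := by
  simpa using antipodeLin_incl_mul_z k 1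
theorem antipodeLin_xz : antipodeLin k (x k * z k) = y k * z k := by
  rw [x, y, antipodeLin_incl_mul_z, KleinAlg.swap_x]
theorem antipodeLin_yz : antipodeLin k (y k * z k) = x k * z k := by
  rw [x, y, antipodeLin_incl_mul_z, KleinAlg.swap_y]
theorem antipodeLin_xyz : antipodeLin k (x k * (y k * z k)) = x k * (y k * z k) := by
  rw [x, y, ← mul_assoc, ← map_mul, antipodeLin_incl_mul_z, map_mul, KleinAlg.swap_x,
    KleinAlg.swap_y, mul_comm]

theorem z_mul_x_mul (a : KP k) : z k * (x k * a) = y k * (z k * a) := by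
  rw [← mul_assoc, z_mul_x, mul_assoc]
theorem z_mul_y_mul (a : KP k) : z k * (y k * a) = x k * (z k * a) := by
  rw [← mul_assoc, z_mul_y, mul_assoc]

variable [NeZero (2 : k)]

theorem comulHom_x : comulHom k (x k) = x k ⊗ₜ x k := by
  rw [comulHom, lift_x]
theorem comulHom_y : comulHom k (y k) = y k ⊗ₜ y k := by
  rw [comulHom, lift_y]
theorem comulHom_z : comulHom k (z k) = comulZ k := by
  rw [comulHom, lift_z]
theorem counitHom_x : counitHom k (x k) = 1 := by
  rw [counitHom, lift_x]
theorem counitHom_y : counitHom k (y k) = 1 := by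
  rw [counitHom, lift_y]
theorem counitHom_z : counitHom k (z k) = 1 := by
  rw [counitHom, lift_z]

noncomputable instance instBialgebra : Bialgebra k (KP k) :=
  Bialgebra.ofAlgHom (comulHom k) (counitHom k)
    (by
      apply algHom_ext
      · simp [comulHom_x]
      · simp [comulHom_y]
      · simp only [AlgHom.comp_apply, comulHom_z, comulZ_expand, map_smul, map_add, map_sub,
          Algebra.TensorProduct.map_tmul, AlgHom.id_apply, map_mul, comulHom_x, comulHom_y,
          mul_smul_comm, mul_add, mul_sub, Algebra.TensorProduct.tmul_mul_tmul,
          TensorProduct.add_tmul, TensorProduct.sub_tmul, TensorProduct.tmul_add,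
          TensorProduct.tmul_sub, TensorProduct.tmul_smul, ← TensorProduct.smul_tmul',
          AlgEquiv.toAlgHom_apply, Algebra.TensorProduct.assoc_tmul, y_mul_y_mul, x_mul_x_mul,
          y_mul_x_mul]
        module)
    (by
      apply algHom_ext
      · simp [comulHom_x, counitHom_x]
      · simp [comulHom_y, counitHom_y]
      · have h2 : (2 : k) ≠ 0 := NeZero.ne 2
        simp [comulHom_z, comulZ_expand, counitHom_y, counitHom_z]
        rw [add_right_comm, add_sub_cancel_right, ← two_smul k, smul_smul, inv_mul_cancel₀ h2,
          one_smul])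
    (by
      apply algHom_ext
      · simp [comulHom_x, counitHom_x]
      · simp [comulHom_y, counitHom_y]
      · have h2 : (2 : k) ≠ 0 := NeZero.ne 2
        simp [comulHom_z, comulZ_expand, counitHom_x, counitHom_z]
        rw [← add_smul, ← two_mul, mul_inv_cancel₀ h2, one_smul])

theorem comul_x : Coalgebra.comul (R := k) (x k) = x k ⊗ₜ x k := comulHom_x k
theorem comul_y : Coalgebra.comul (R := k) (y k) = y k ⊗ₜ y k := comulHom_y k
theorem comul_z : Coalgebra.comul (R := k) (z k) =
    (2 : k)⁻¹ • ((1 ⊗ₜ 1 + 1 ⊗ₜ x k + y k ⊗ₜ 1 - y k ⊗ₜ x k) * (z k ⊗ₜ z k)) := comulHom_z k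
theorem counit_x : Coalgebra.counit (R := k) (x k) = 1 := counitHom_x k
theorem counit_y : Coalgebra.counit (R := k) (y k) = 1 := counitHom_y k
theorem counit_z : Coalgebra.counit (R := k) (z k) = 1 := counitHom_z k

theorem antipode_aux (a : KP k) (h : a = ((2 : k)⁻¹ * 2⁻¹ * (2 * 2)) • (1 : KP k)) : a = 1 := by
  have h2 : (2 : k) ≠ 0 := NeZero.ne 2
  have : (2 : k)⁻¹ * 2⁻¹ * (2 * 2) = 1 := by field_simp
  rw [h, this, one_smul]

noncomputable instance instHopfAlgebra : HopfAlgebra k (KP k) where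
  antipode := antipodeLin k
  mul_antipode_rTensor_comul := by
    have hq := antipode_aux k
    have e := comul_z k
    rw [← comulZ, comulZ_expand] at e
    apply linearMap_ext
    · rintro a (rfl | rfl | rfl | rfl) <;>
        simp [comul_x, comul_y, counit_x, counit_y, antipodeLin_one, antipodeLin_x, antipodeLin_y,
          antipodeLin_xy, x_mul_x, y_mul_y, mul_assoc, y_mul_x_mul,
          Algebra.TensorProduct.one_def]
    · rintro a (rfl | rfl | rfl | rfl) <;>
        simp [comul_x, comul_y, e, counit_x, counit_y, counit_z, mul_add, mul_sub, mul_assoc,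
          x_mul_x_mul, y_mul_y_mul, y_mul_x_mul, antipodeLin_z, antipodeLin_xz, antipodeLin_yz,
          antipodeLin_xyz, z_mul_x_mul, z_mul_y_mul, z_mul_z, x_mul_x, y_mul_y, ← x_mul_y,
          smul_add, smul_sub, smul_smul] <;>
        exact hq _ (by module)
  mul_antipode_lTensor_comul := by
    have hq := antipode_aux k
    have e := comul_z k
    rw [← comulZ, comulZ_expand] at e
    apply linearMap_ext
    · rintro a (rfl | rfl | rfl | rfl) <;>
        simp [comul_x, comul_y, counit_x, counit_y, antipodeLin_one, antipodeLin_x, antipodeLin_y,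
          antipodeLin_xy, x_mul_x, y_mul_y, mul_assoc, y_mul_x_mul,
          Algebra.TensorProduct.one_def]
    · rintro a (rfl | rfl | rfl | rfl) <;>
        simp [comul_x, comul_y, e, counit_x, counit_y, counit_z, mul_add, mul_sub, mul_assoc,
          x_mul_x_mul, y_mul_y_mul, y_mul_x_mul, antipodeLin_z, antipodeLin_xz, antipodeLin_yz,
          antipodeLin_xyz, z_mul_x_mul, z_mul_y_mul, z_mul_z, x_mul_x, y_mul_y, ← x_mul_y,
          smul_add, smul_sub, smul_smul] <;>
        exact hq _ (by module)

end hopf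
end KP

section comoduleAlgebras
variable (k : Type*) [Field k] (H : Type*) [Ring H] [Bialgebra k H]

/-- The structure of a left `H`-comodule algebra on an algebra `A`: a coassociative and counital
algebra map `A → H ⊗ A`. -/
structure LeftCoaction (A : Type*) [Ring A] [Algebra k A] where
  toAlgHom : A →ₐ[k] H ⊗[k] A
  coassoc : ∀ a, Algebra.TensorProduct.assoc k k k H H A
      (Algebra.TensorProduct.map (Bialgebra.comulAlgHom k H) (AlgHom.id k A) (toAlgHom a)) =
    Algebra.TensorProduct.map (AlgHom.id k H) toAlgHom (toAlgHom a)
  counit : ∀ a, Algebra.TensorProduct.lid k A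
    (Algebra.TensorProduct.map (Bialgebra.counitAlgHom k H) (AlgHom.id k A) (toAlgHom a)) = a

namespace LeftCoaction
variable {k H} {A : Type*} [Ring A] [Algebra k A] {B : Type*} [Ring B] [Algebra k B]

/-- The coinvariants `{a | λ(a) = 1 ⊗ a}`. -/
noncomputable def coinvariants (ρ : LeftCoaction k H A) : Subalgebra k A :=
  AlgHom.equalizer ρ.toAlgHom Algebra.TensorProduct.includeRight

/-- `V` is an `H`-subcomodule of `A`, that is, `λ(V) ⊆ H ⊗ V`. -/
def IsCostable (ρ : LeftCoaction k H A) (V : Submodule k A) : Prop :=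
  ∀ a ∈ V, ρ.toAlgHom a ∈ LinearMap.range (V.subtype.lTensor H)

/-- `A` is right `H`-simple: it is nonzero, and the only costable right ideals are `0` and `A`. -/
structure IsRightSimple (ρ : LeftCoaction k H A) : Prop where
  nontrivial : Nontrivial A
  eq_bot_or_eq_top : ∀ V : Submodule k A, (∀ a ∈ V, ∀ b, a * b ∈ V) → ρ.IsCostable V →
    V = ⊥ ∨ V = ⊤

/-- `A` is AM-exact: finite-dimensional, right `H`-simple, and with trivial coinvariants. -/
structure IsAMExact (ρ : LeftCoaction k H A) : Prop where
  finiteDimensional : FiniteDimensional k A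
  isRightSimple : ρ.IsRightSimple
  coinvariants_eq_bot : ρ.coinvariants = ⊥

/-- Isomorphisms of `H`-comodule algebras. -/
structure Iso (ρ : LeftCoaction k H A) (σ : LeftCoaction k H B) where
  toAlgEquiv : A ≃ₐ[k] B
  map_coaction : ∀ a, σ.toAlgHom (toAlgEquiv a) =
    Algebra.TensorProduct.map (AlgHom.id k H) (toAlgEquiv : A →ₐ[k] B) (ρ.toAlgHom a)

end LeftCoaction

/-- A (left) coideal subalgebra of `H`: a subalgebra `B` with `Δ(B) ⊆ H ⊗ B`. -/
structure CoidealSubalgebra extends Subalgebra k H where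
  comul_mem : ∀ b ∈ toSubalgebra, Coalgebra.comul (R := k) b ∈
    LinearMap.range ((Subalgebra.toSubmodule toSubalgebra).subtype.lTensor H)

namespace CoidealSubalgebra
variable {k H} (B : CoidealSubalgebra k H)

/-- The inclusion `H ⊗ B → H ⊗ H`. -/
noncomputable def tensorVal : H ⊗[k] B.toSubalgebra →ₐ[k] H ⊗[k] H :=
  Algebra.TensorProduct.map (AlgHom.id k H) B.toSubalgebra.val

theorem tensorVal_injective : Function.Injective B.tensorVal :=
  Module.Flat.lTensor_preserves_injective_linearMap (M := H) B.toSubalgebra.val.toLinearMap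
    Subtype.val_injective

/-- `B` is a left `H`-comodule algebra via the restriction of the comultiplication. -/
noncomputable def coactionHom : B.toSubalgebra →ₐ[k] H ⊗[k] B.toSubalgebra :=
  (AlgEquiv.ofInjective B.tensorVal B.tensorVal_injective).symm.toAlgHom.comp
    (((Bialgebra.comulAlgHom k H).comp B.toSubalgebra.val).codRestrict B.tensorVal.range
      (fun b => B.comul_mem b.1 b.2))

theorem tensorVal_coactionHom (b : B.toSubalgebra) :
    B.tensorVal (B.coactionHom b) = Coalgebra.comul (R := k) (b : H) :=
  congrArg Subtype.val ((AlgEquiv.ofInjective B.tensorVal B.tensorVal_injective).apply_symm_apply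
    (((Bialgebra.comulAlgHom k H).comp B.toSubalgebra.val).codRestrict B.tensorVal.range
      (fun b => B.comul_mem b.1 b.2) b))

noncomputable def coaction : LeftCoaction k H B.toSubalgebra where
  toAlgHom := B.coactionHom
  coassoc b := by
    have inj : Function.Injective (Algebra.TensorProduct.map (AlgHom.id k H) B.tensorVal) :=
      Module.Flat.lTensor_preserves_injective_linearMap (M := H) B.tensorVal.toLinearMap
        B.tensorVal_injective
    apply inj
    have e1 : ∀ t : H ⊗[k] B.toSubalgebra,
        Algebra.TensorProduct.map (AlgHom.id k H) B.tensorVal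
          (Algebra.TensorProduct.assoc k k k H H B.toSubalgebra
            (Algebra.TensorProduct.map (Bialgebra.comulAlgHom k H) (AlgHom.id k B.toSubalgebra) t))
        = Algebra.TensorProduct.assoc k k k H H H
          (Algebra.TensorProduct.map (Bialgebra.comulAlgHom k H) (AlgHom.id k H)
            (B.tensorVal t)) := by
      have : ∀ (u : H ⊗[k] H) (b : B.toSubalgebra),
          Algebra.TensorProduct.map (AlgHom.id k H) B.tensorVal
            (Algebra.TensorProduct.assoc k k k H H B.toSubalgebra (u ⊗ₜ b)) =
          Algebra.TensorProduct.assoc k k k H H H (u ⊗ₜ (b : H)) := by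
        intro u b
        induction u using TensorProduct.induction_on with
        | zero => simp
        | tmul a c => simp [tensorVal]
        | add a c ha hc => rw [TensorProduct.add_tmul, TensorProduct.add_tmul, map_add, map_add,
            map_add, ha, hc]
      intro t
      induction t using TensorProduct.induction_on with
      | zero => simp
      | tmul h b => simp [tensorVal] at this ⊢; exact this _ _ b.2
      | add a c ha hc => simp only [map_add, ha, hc]
    have e2 : ∀ t : H ⊗[k] B.toSubalgebra,
        Algebra.TensorProduct.map (AlgHom.id k H) B.tensorVal
          (Algebra.TensorProduct.map (AlgHom.id k H) B.coactionHom t) =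
        Algebra.TensorProduct.map (AlgHom.id k H) (Bialgebra.comulAlgHom k H) (B.tensorVal t) := by
      intro t
      induction t using TensorProduct.induction_on with
      | zero => simp
      | tmul h b =>
        have := B.tensorVal_coactionHom b
        simp [this]
        simp [tensorVal]
      | add a c ha hc => simp only [map_add, ha, hc]
    rw [e1, e2, tensorVal_coactionHom]
    exact Coalgebra.coassoc_apply (R := k) (b : H)
  counit b := by
    apply Subtype.val_injective
    have e1 : ∀ t : H ⊗[k] B.toSubalgebra,
        ((Algebra.TensorProduct.lid k B.toSubalgebra
          (Algebra.TensorProduct.map (Bialgebra.counitAlgHom k H) (AlgHom.id k B.toSubalgebra) t) :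
            B.toSubalgebra) : H) =
        Algebra.TensorProduct.lid k H
          (Algebra.TensorProduct.map (Bialgebra.counitAlgHom k H) (AlgHom.id k H)
            (B.tensorVal t)) := by
      intro t
      induction t using TensorProduct.induction_on with
      | zero => simp
      | tmul h b => simp [tensorVal]
      | add a c ha hc => simp only [map_add, ha, hc, Subalgebra.coe_add]
    rw [e1, tensorVal_coactionHom]
    have := Coalgebra.rTensor_counit_comul (R := k) (b : H)
    change Algebra.TensorProduct.lid k H ((Coalgebra.counit (R := k)).rTensor H
      (Coalgebra.comul (R := k) (b : H))) = _
    rw [this]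
    simp

end CoidealSubalgebra
end comoduleAlgebras

section twisted

/-- Normalized 2-cocycles of a group with values in `kˣ`. -/
structure TwoCocycle (k : Type*) [Field k] (G : Type*) [Group G] where
  toFun : G → G → kˣ
  one_left : ∀ g, toFun 1 g = 1
  one_right : ∀ g, toFun g 1 = 1
  cocycle : ∀ g h l, toFun g h * toFun (g * h) l = toFun g (h * l) * toFun h l

/-- The twisted group algebra `k^ψ[G]`, with basis `(e g)` and `e g * e h = ψ(g, h) e (g h)`. -/
@[ext] structure TwistedGroupAlgebra {k : Type*} [Field k] {G : Type*} [Group G]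
    (ψ : TwoCocycle k G) where
  coeff : G →₀ k

namespace TwistedGroupAlgebra
variable {k : Type*} [Field k] {G : Type*} [Group G] {ψ : TwoCocycle k G}

/-- The underlying vector space. -/
def equivFinsupp : TwistedGroupAlgebra ψ ≃ (G →₀ k) where
  toFun p := p.coeff
  invFun f := ⟨f⟩

noncomputable instance instAddCommGroup : AddCommGroup (TwistedGroupAlgebra ψ) :=
  equivFinsupp.addCommGroup
noncomputable instance instModule : Module k (TwistedGroupAlgebra ψ) := equivFinsupp.module k

theorem add_coeff (p q : TwistedGroupAlgebra ψ) : (p + q).coeff = p.coeff + q.coeff := rfl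
theorem zero_coeff : (0 : TwistedGroupAlgebra ψ).coeff = 0 := rfl
theorem smul_coeff (r : k) (p : TwistedGroupAlgebra ψ) : (r • p).coeff = r • p.coeff := rfl

variable (ψ) in
/-- The basis elements. -/
noncomputable def e (g : G) : TwistedGroupAlgebra ψ := ⟨Finsupp.single g 1⟩

variable (ψ) in
/-- The bilinear map with `(e g, e h) ↦ ψ(g, h) e (g h)`. -/
noncomputable def mulLin : (G →₀ k) →ₗ[k] (G →₀ k) →ₗ[k] (G →₀ k) :=
  Finsupp.linearCombination k (fun g => Finsupp.linearCombination k
    (fun h => Finsupp.single (g * h) (ψ.toFun g h : k)))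

noncomputable instance instMul : Mul (TwistedGroupAlgebra ψ) where
  mul p q := ⟨mulLin ψ p.coeff q.coeff⟩
noncomputable instance instOne : One (TwistedGroupAlgebra ψ) where
  one := e ψ 1

theorem mul_coeff (p q : TwistedGroupAlgebra ψ) : (p * q).coeff = mulLin ψ p.coeff q.coeff := rfl
theorem one_coeff : (1 : TwistedGroupAlgebra ψ).coeff = Finsupp.single 1 1 := rfl

theorem mulLin_single (g h : G) (r s : k) : mulLin ψ (Finsupp.single g r) (Finsupp.single h s) =
    Finsupp.single (g * h) (r * s * (ψ.toFun g h : k)) := by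
  simp only [mulLin, Finsupp.linearCombination_single, LinearMap.smul_apply, Finsupp.smul_single,
    smul_eq_mul, mul_assoc]

noncomputable instance instRing : Ring (TwistedGroupAlgebra ψ) where
  __ := instAddCommGroup (ψ := ψ)
  __ := instMul (ψ := ψ)
  __ := instOne (ψ := ψ)
  left_distrib p q r := by apply TwistedGroupAlgebra.ext; simp [mul_coeff, add_coeff]
  right_distrib p q r := by apply TwistedGroupAlgebra.ext; simp [mul_coeff, add_coeff]
  zero_mul p := by apply TwistedGroupAlgebra.ext; simp [mul_coeff, zero_coeff]
  mul_zero p := by apply TwistedGroupAlgebra.ext; simp [mul_coeff, zero_coeff]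
  mul_assoc p q r := by
    apply TwistedGroupAlgebra.ext
    simp only [mul_coeff]
    induction p.coeff using Finsupp.induction_linear with
    | zero => simp
    | add a b ha hb => simp only [map_add, LinearMap.add_apply, ha, hb]
    | single g a =>
      induction q.coeff using Finsupp.induction_linear with
      | zero => simp
      | add a b ha hb => simp only [map_add, LinearMap.add_apply, ha, hb]
      | single h b =>
        induction r.coeff using Finsupp.induction_linear with
        | zero => simp
        | add a b ha hb => simp only [map_add, ha, hb]
        | single l c =>
          have := congrArg (fun u : kˣ => (u : k)) (ψ.cocycle g h l)
          simp only [Units.val_mul] at this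
          simp only [mulLin_single, mul_assoc g h l]
          congr 1
          linear_combination a * b * c * this
  one_mul p := by
    apply TwistedGroupAlgebra.ext
    simp only [mul_coeff, one_coeff]
    induction p.coeff using Finsupp.induction_linear with
    | zero => simp
    | add a b ha hb => simp only [map_add, ha, hb]
    | single g a => simp [mulLin_single, ψ.one_left]
  mul_one p := by
    apply TwistedGroupAlgebra.ext
    simp only [mul_coeff, one_coeff]
    induction p.coeff using Finsupp.induction_linear with
    | zero => simp
    | add a b ha hb => simp only [map_add, LinearMap.add_apply, ha, hb]
    | single g a => simp [mulLin_single, ψ.one_right]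

noncomputable instance instAlgebra : Algebra k (TwistedGroupAlgebra ψ) := Algebra.ofModule
  (fun r p q => by apply TwistedGroupAlgebra.ext; simp [mul_coeff, smul_coeff])
  (fun r p q => by apply TwistedGroupAlgebra.ext; simp [mul_coeff, smul_coeff])

theorem e_mul_e (g h : G) : e ψ g * e ψ h = (ψ.toFun g h : k) • e ψ (g * h) := by
  apply TwistedGroupAlgebra.ext; simp [mul_coeff, smul_coeff, e, mulLin_single]

theorem induction_on {P : TwistedGroupAlgebra ψ → Prop} (p : TwistedGroupAlgebra ψ)
    (h0 : P 0) (hadd : ∀ p q, P p → P q → P (p + q)) (he : ∀ (r : k) g, P (r • e ψ g)) : P p := by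
  obtain ⟨f⟩ := p
  induction f using Finsupp.induction_linear with
  | zero => exact h0
  | add a b ha hb => exact hadd _ _ ha hb
  | single g r =>
    have : (⟨Finsupp.single g r⟩ : TwistedGroupAlgebra ψ) = r • e ψ g := by
      apply TwistedGroupAlgebra.ext; simp [smul_coeff, e]
    rw [this]; exact he r g

section coaction
variable {H : Type*} [Ring H] [Bialgebra k H] (φ : G →* H)

/-- The linear map with `e g ↦ φ(g) ⊗ e g`. -/
noncomputable def coactionLin : TwistedGroupAlgebra ψ →ₗ[k] H ⊗[k] TwistedGroupAlgebra ψ where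
  toFun p := Finsupp.linearCombination k (fun g => φ g ⊗ₜ[k] e ψ g) p.coeff
  map_add' p q := by rw [add_coeff, map_add]
  map_smul' r p := by rw [smul_coeff, map_smul, RingHom.id_apply]

theorem coactionLin_e (g : G) : coactionLin φ (e ψ g) = φ g ⊗ₜ e ψ g := by
  simp [coactionLin, e]

noncomputable def coactionHom : TwistedGroupAlgebra ψ →ₐ[k] H ⊗[k] TwistedGroupAlgebra ψ :=
  AlgHom.ofLinearMap (coactionLin φ)
    (by
      have : (1 : TwistedGroupAlgebra ψ) = e ψ 1 := rfl
      rw [this, coactionLin_e, map_one]; rfl)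
    (fun p q => by
      induction p using induction_on with
      | h0 => simp
      | hadd p p' h h' => simp only [add_mul, map_add, h, h']
      | he r g =>
        induction q using induction_on with
        | h0 => simp
        | hadd p p' h h' => simp only [mul_add, map_add, h, h']
        | he s h => simp only [smul_mul_assoc, mul_smul_comm, map_smul, e_mul_e, coactionLin_e,
            Algebra.TensorProduct.tmul_mul_tmul, map_mul, TensorProduct.tmul_smul])

theorem coactionHom_e (g : G) : coactionHom φ (e ψ g) = φ g ⊗ₜ e ψ g := coactionLin_e φ g

/-- The comodule algebra structure `e g ↦ φ(g) ⊗ e g` on `k^ψ[G]`, for a homomorphism `φ` from `G`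
to the grouplike elements of `H`. -/
noncomputable def coaction (hφ : ∀ g, IsGroupLikeElem k (φ g)) :
    LeftCoaction k H (TwistedGroupAlgebra ψ) where
  toAlgHom := coactionHom φ
  coassoc p := by
    induction p using induction_on with
    | h0 => simp
    | hadd p q hp hq => simp only [map_add, hp, hq]
    | he r g =>
      simp only [map_smul, coactionHom_e, Algebra.TensorProduct.map_tmul, AlgHom.id_apply,
        Bialgebra.comulAlgHom_apply, (hφ g).comul_eq_tmul_self, Algebra.TensorProduct.assoc_tmul]
  counit p := by
    induction p using induction_on with
    | h0 => simp
    | hadd p q hp hq => simp only [map_add, hp, hq]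
    | he r g => simp [coactionHom_e, (hφ g).counit_eq_one]

end coaction
end TwistedGroupAlgebra
end twisted

section klein
variable (k : Type*) [Field k]

/-- The cocycle `ψ(x^i y^j, x^k y^l) = (-1)^(j k)` of the Klein four-group. -/
def Klein.cocycle : TwoCocycle k Klein where
  toFun g h := (-1) ^ (g.2.toAdd.val * h.1.toAdd.val)
  one_left g := by simp
  one_right g := by simp
  cocycle g h l := by
    have key : ∀ g h l : Klein,
        (-1 : ℤˣ) ^ (g.2.toAdd.val * h.1.toAdd.val) *
          (-1 : ℤˣ) ^ ((g * h).2.toAdd.val * l.1.toAdd.val) =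
        (-1 : ℤˣ) ^ (g.2.toAdd.val * (h * l).1.toAdd.val) *
          (-1 : ℤˣ) ^ (h.2.toAdd.val * l.1.toAdd.val) := by decide
    have := congrArg (Units.map (Int.castRingHom k : ℤ →* k)) (key g h l)
    have e1 : Units.map (Int.castRingHom k : ℤ →* k) (-1) = -1 := by
      apply Units.ext; simp
    simpa only [map_mul, map_pow, e1] using this

namespace KP
variable [NeZero (2 : k)]

/-- The inclusion of `K` into the grouplike elements of `KP`. -/
noncomputable def ofKlein : Klein →* KP k :=
  (incl (k := k) : KleinAlg k →* KP k).comp (MonoidAlgebra.of k Klein)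

theorem isGroupLikeElem_ofKlein (g : Klein) : IsGroupLikeElem k (ofKlein k g) where
  counit_eq_one := by
    have : ofKlein k g = x k ^ (g.1.toAdd.val) * y k ^ (g.2.toAdd.val) := by
      change incl (MonoidAlgebra.of k Klein g) = _
      rw [KleinAlg.of_eq, map_mul, map_pow, map_pow]; rfl
    rw [this]
    simp [counit_x, counit_y]
  comul_eq_tmul_self := by
    have : ofKlein k g = x k ^ (g.1.toAdd.val) * y k ^ (g.2.toAdd.val) := by
      change incl (MonoidAlgebra.of k Klein g) = _
      rw [KleinAlg.of_eq, map_mul, map_pow, map_pow]; rfl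
    rw [this]
    simp [comul_x, comul_y]

/-- The `KP`-comodule algebra `k^ψ[K]`, with coaction `e g ↦ g ⊗ e g`. -/
noncomputable def twistedCoaction :
    LeftCoaction k (KP k) (TwistedGroupAlgebra (Klein.cocycle k)) :=
  TwistedGroupAlgebra.coaction (ofKlein k) (isGroupLikeElem_ofKlein k)

end KP
end klein

/-! As a coalgebra, `KP` is the sum of the four lines spanned by `K` and a 2×2 matrix coalgebra with
entries `c00`, ..., `c11`. A comodule algebra `A` therefore splits into the semi-invariants of
weights 1, x, y, xy and copies of one two-dimensional simple comodule; the latter are recorded by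
the space `pairs`.

A character χ of `A` suffices for the first alternative: `(id ⊗ χ) λ` is a morphism of comodule
algebras from `A` to `KP`, its kernel is a proper costable right ideal, so right simplicity makes it
an embedding (`IsRightSimple.exists_coidealSubalgebra`). The work is to find a character whenever
`A` is not the twisted group algebra.

Simplicity and trivial coinvariants make every nonzero semi-invariant a unit, which can be scaled to
have square 1 and spans its weight space (`exists_normalized`). A product of entries of two pairs
has only weight components. Its invariant component is a scalar, which gives a bilinear form on
`pairs`, and simplicity makes this form nondegenerate in its left argument (`exists_beta1_ne_zero`).
Associativity for three entries, compared in one isotypic slot, ties the form to the operators by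
which semi-invariants act on `pairs` from the left and from the right.

The weights that occur form a subgroup of `K`. For the trivial group, or the one generated by x or
by y, associativity kills `pairs`. For the group generated by xy it forces the two actions of the
unit of weight xy to agree. For the whole of `K`, let a and b be the normalized units of weights x
and y; then `a * b = ± b * a`. If they anticommute, `pairs` vanishes and `A` is the twisted group
algebra. If they commute, right multiplication by a is left multiplication by b up to a sign α, and
vice versa.

In every case except the anticommuting one there is a nonzero central element f on which all
semi-invariants act by scalars. The ideal `A f` is then a module on which `A` acts through commuting
operators, and this yields a character (`exists_character_of_weights`). -/

open scoped TensorProduct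

/-! ### A basis of `KP` adapted to its coalgebra structure. -/

namespace KP
section coordinates
variable (k : Type*) [Field k]

/-- The matrix coefficients `c i j` of the two-dimensional simple comodule `⟨z, x z⟩`. -/
noncomputable def c00 : KP k := (2 : k)⁻¹ • (z k + y k * z k)
noncomputable def c01 : KP k := (2 : k)⁻¹ • (z k - y k * z k)
noncomputable def c10 : KP k := (2 : k)⁻¹ • (x k * z k - x k * (y k * z k))
noncomputable def c11 : KP k := (2 : k)⁻¹ • (x k * z k + x k * (y k * z k))

/-- The coordinate functionals of `KP` with respect to `g` and `g z`, for `g` in `K`. -/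
noncomputable def coordFst (g : Klein) : KP k →ₗ[k] k where
  toFun p := p.fst.coeff g
  map_add' p q := by simp [add_fst]
  map_smul' r p := by simp [smul_fst]

noncomputable def coordSnd (g : Klein) : KP k →ₗ[k] k where
  toFun p := p.snd.coeff g
  map_add' p q := by simp [add_snd]
  map_smul' r p := by simp [smul_snd]

theorem coordFst_apply (g : Klein) (p : KP k) : coordFst k g p = p.fst.coeff g := rfl
theorem coordSnd_apply (g : Klein) (p : KP k) : coordSnd k g p = p.snd.coeff g := rfl

theorem coords_incl (g : Klein) : ∀ h,
    coordFst k g (incl (MonoidAlgebra.of k Klein h)) = (if h = g then 1 else 0) ∧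
    coordSnd k g (incl (MonoidAlgebra.of k Klein h)) = 0 ∧
    coordFst k g (incl (MonoidAlgebra.of k Klein h) * z k) = 0 ∧
    coordSnd k g (incl (MonoidAlgebra.of k Klein h) * z k) = (if h = g then 1 else 0) := by
  classical
  intro h
  simp [coordFst_apply, coordSnd_apply, incl_fst, incl_snd, mul_fst, mul_snd, z_fst, z_snd,
    Finsupp.single_apply]

theorem of_one : incl (MonoidAlgebra.of k Klein 1) = (1 : KP k) := by rw [map_one, map_one]
theorem of_x : incl (MonoidAlgebra.of k Klein Klein.x) = x k := rfl
theorem of_y : incl (MonoidAlgebra.of k Klein Klein.y) = y k := rfl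
theorem of_xy : incl (MonoidAlgebra.of k Klein (Klein.x * Klein.y)) = x k * y k := by
  rw [map_mul, map_mul, of_x, of_y]

theorem coords (g : Klein) :
    (coordFst k g 1 = (if 1 = g then 1 else 0) ∧
      coordFst k g (x k) = (if Klein.x = g then 1 else 0) ∧
      coordFst k g (y k) = (if Klein.y = g then 1 else 0) ∧
      coordFst k g (x k * y k) = (if Klein.x * Klein.y = g then 1 else 0) ∧
      coordFst k g (z k) = 0 ∧ coordFst k g (x k * z k) = 0 ∧
      coordFst k g (y k * z k) = 0 ∧ coordFst k g (x k * (y k * z k)) = 0) ∧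
    coordSnd k g 1 = 0 ∧ coordSnd k g (x k) = 0 ∧ coordSnd k g (y k) = 0 ∧
      coordSnd k g (x k * y k) = 0 ∧
      coordSnd k g (z k) = (if 1 = g then 1 else 0) ∧
      coordSnd k g (x k * z k) = (if Klein.x = g then 1 else 0) ∧
      coordSnd k g (y k * z k) = (if Klein.y = g then 1 else 0) ∧
      coordSnd k g (x k * (y k * z k)) = (if Klein.x * Klein.y = g then 1 else 0) := by
  have h1 := coords_incl k g 1
  have h2 := coords_incl k g Klein.x
  have h3 := coords_incl k g Klein.y
  have h4 := coords_incl k g (Klein.x * Klein.y)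
  rw [of_one, one_mul] at h1
  rw [of_x] at h2
  rw [of_y] at h3
  rw [of_xy, mul_assoc (x k) (y k) (z k)] at h4
  exact ⟨⟨h1.1, h2.1, h3.1, h4.1, h1.2.2.1, h2.2.2.1, h3.2.2.1, h4.2.2.1⟩,
    h1.2.1, h2.2.1, h3.2.1, h4.2.1, h1.2.2.2, h2.2.2.2, h3.2.2.2, h4.2.2.2⟩

variable {k} {M : Type*} [AddCommGroup M] [Module k M]

/-- The element of `KP ⊗ M` with given coordinates in the basis `1, x, y, xy, c i j`. -/
noncomputable def comb (p1 px py pxy q00 q01 q10 q11 : M) : KP k ⊗[k] M :=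
  1 ⊗ₜ p1 + x k ⊗ₜ px + y k ⊗ₜ py + (x k * y k) ⊗ₜ pxy +
    (c00 k ⊗ₜ q00 + c01 k ⊗ₜ q01 + c10 k ⊗ₜ q10 + c11 k ⊗ₜ q11)

theorem comb_add (p1 px py pxy q00 q01 q10 q11 p1' px' py' pxy' q00' q01' q10' q11' : M) :
    comb (k := k) p1 px py pxy q00 q01 q10 q11 + comb p1' px' py' pxy' q00' q01' q10' q11' =
    comb (p1 + p1') (px + px') (py + py') (pxy + pxy') (q00 + q00') (q01 + q01') (q10 + q10')
      (q11 + q11') := by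
  simp only [comb, TensorProduct.tmul_add]; abel

theorem eq_smul_basis [NeZero (2 : k)] (h : KP k) : ∃ r : Fin 8 → k,
    h = r 0 • 1 + r 1 • x k + r 2 • y k + r 3 • (x k * y k) +
      (r 4 • c00 k + r 5 • c01 k + r 6 • c10 k + r 7 • c11 k) := by
  have h2 : (2 : k) ≠ 0 := NeZero.ne 2
  let cF : Klein → KP k →ₗ[k] k := coordFst k
  let cS : Klein → KP k →ₗ[k] k := coordSnd k
  -- The coefficients come from `z = c00 + c01`, `y z = c00 - c01`, `x z = c10 + c11` and `x y z =
  -- c11 - c10`.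
  have key : LinearMap.id = (cF 1).smulRight 1 + (cF Klein.x).smulRight (x k) +
      (cF Klein.y).smulRight (y k) + (cF (Klein.x * Klein.y)).smulRight (x k * y k) +
      ((cS 1 + cS Klein.y).smulRight (c00 k) + (cS 1 - cS Klein.y).smulRight (c01 k) +
       (cS Klein.x - cS (Klein.x * Klein.y)).smulRight (c10 k) +
       (cS Klein.x + cS (Klein.x * Klein.y)).smulRight (c11 k)) := by
    have d1 : Klein.x ≠ 1 := by decide
    have d2 : Klein.y ≠ 1 := by decide
    have d3 : Klein.x ≠ Klein.y := by decide
    have d4 : Klein.x * Klein.y ≠ 1 := by decide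
    apply linearMap_ext
    · rintro a (rfl | rfl | rfl | rfl) <;>
      simp [cF, cS, coords, d1, d2, d3, d1.symm, d2.symm, d3.symm, d4, d4.symm]
    · rintro a (rfl | rfl | rfl | rfl) <;>
      simp [cF, cS, coords, d1, d2, d3, d1.symm, d2.symm, d3.symm, d4, d4.symm, mul_assoc,
        c00, c01, c10, c11] <;> match_scalars <;> field_simp <;> norm_num
  refine ⟨![cF 1 h, cF Klein.x h, cF Klein.y h, cF (Klein.x * Klein.y) h, cS 1 h + cS Klein.y h,
    cS 1 h - cS Klein.y h, cS Klein.x h - cS (Klein.x * Klein.y) h,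
    cS Klein.x h + cS (Klein.x * Klein.y) h], ?_⟩
  exact LinearMap.congr_fun key h

theorem exists_comb [NeZero (2 : k)] (t : KP k ⊗[k] M) : ∃ p1 px py pxy q00 q01 q10 q11 : M,
    t = comb p1 px py pxy q00 q01 q10 q11 := by
  induction t using TensorProduct.induction_on with
  | zero => exact ⟨0, 0, 0, 0, 0, 0, 0, 0, by simp [comb]⟩
  | tmul h m =>
    obtain ⟨r, hr⟩ := eq_smul_basis h
    refine ⟨r 0 • m, r 1 • m, r 2 • m, r 3 • m, r 4 • m, r 5 • m, r 6 • m, r 7 • m, ?_⟩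
    rw [hr]
    simp only [comb, TensorProduct.add_tmul, TensorProduct.smul_tmul]
  | add a b ha hb =>
    obtain ⟨_, _, _, _, _, _, _, _, rfl⟩ := ha
    obtain ⟨_, _, _, _, _, _, _, _, rfl⟩ := hb
    exact ⟨_, _, _, _, _, _, _, _, comb_add ..⟩

/-- Contracting the left factor with the eight coordinate functionals leaves halves of sums and
differences of the `q`'s, which can be solved because 2 is invertible. -/
theorem comb_eq_zero [NeZero (2 : k)] {p1 px py pxy q00 q01 q10 q11 : M}
    (h : comb (k := k) p1 px py pxy q00 q01 q10 q11 = 0) :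
    p1 = 0 ∧ px = 0 ∧ py = 0 ∧ pxy = 0 ∧ q00 = 0 ∧ q01 = 0 ∧ q10 = 0 ∧ q11 = 0 := by
  have h2 : (2 : k) ≠ 0 := NeZero.ne 2
  have d1 : Klein.x ≠ 1 := by decide
  have d2 : Klein.y ≠ 1 := by decide
  have d3 : Klein.x ≠ Klein.y := by decide
  have d4 : Klein.x * Klein.y ≠ 1 := by decide
  have eF : ∀ g, TensorProduct.lid k M ((coordFst k g).rTensor M
      (comb (k := k) p1 px py pxy q00 q01 q10 q11)) = 0 := by simp [h]
  have eS : ∀ g, TensorProduct.lid k M ((coordSnd k g).rTensor M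
      (comb (k := k) p1 px py pxy q00 q01 q10 q11)) = 0 := by simp [h]
  have f1 := eF 1
  have f2 := eF Klein.x
  have f3 := eF Klein.y
  have f4 := eF (Klein.x * Klein.y)
  have s1 := eS 1
  have s2 := eS Klein.x
  have s3 := eS Klein.y
  have s4 := eS (Klein.x * Klein.y)
  simp [comb, coords, c00, c01, c10, c11, d1, d2, d3, d1.symm, d2.symm, d3.symm, d4, d4.symm] at f1 f2 f3 f4 s1 s2 s3 s4
  have halves : ∀ u : M, u = (2 : k)⁻¹ • u + (2 : k)⁻¹ • u := fun u => by
    match_scalars; field_simp; norm_num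
  refine ⟨f1, f2, f3, f4, ?_, ?_, ?_, ?_⟩
  · linear_combination (norm := module) s1 + s3 + halves q00
  · linear_combination (norm := module) s1 - s3 + halves q01
  · linear_combination (norm := module) s2 - s4 + halves q10
  · linear_combination (norm := module) s2 + s4 + halves q11

theorem comb_inj [NeZero (2 : k)] {p1 px py pxy q00 q01 q10 q11 p1' px' py' pxy' q00' q01' q10'
    q11' : M} (h : comb (k := k) p1 px py pxy q00 q01 q10 q11 =
      comb p1' px' py' pxy' q00' q01' q10' q11') :
    p1 = p1' ∧ px = px' ∧ py = py' ∧ pxy = pxy' ∧ q00 = q00' ∧ q01 = q01' ∧ q10 = q10' ∧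
      q11 = q11' := by
  have : comb (k := k) (p1 - p1') (px - px') (py - py') (pxy - pxy') (q00 - q00') (q01 - q01')
      (q10 - q10') (q11 - q11') = 0 := by
    rw [← sub_eq_zero] at h
    rw [← h]
    simp only [comb, TensorProduct.tmul_sub]; abel
  simpa only [sub_eq_zero] using comb_eq_zero this

end coordinates

/-! ### Multiplication and comultiplication of the matrix coefficients. -/

section relations
variable (k : Type*) [Field k]

theorem x_mul_c00 : x k * c00 k = c11 k := by
  simp [c00, c11, mul_add]
theorem x_mul_c01 : x k * c01 k = c10 k := by
  simp [c01, c10, mul_sub]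
theorem x_mul_c10 : x k * c10 k = c01 k := by
  simp [c01, c10, mul_sub, x_mul_x_mul]
theorem x_mul_c11 : x k * c11 k = c00 k := by
  simp [c00, c11, mul_add, x_mul_x_mul]
theorem y_mul_c00 : y k * c00 k = c00 k := by
  simp [c00, mul_add, y_mul_y_mul, add_comm]
theorem y_mul_c01 : y k * c01 k = -c01 k := by
  simp [c01, mul_sub, y_mul_y_mul, ← smul_neg]
theorem y_mul_c10 : y k * c10 k = -c10 k := by
  simp [c10, mul_sub, y_mul_y_mul, ← smul_neg, y_mul_x_mul]
theorem y_mul_c11 : y k * c11 k = c11 k := by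
  simp [c11, mul_add, y_mul_y_mul, y_mul_x_mul, add_comm]
theorem c00_mul_x : c00 k * x k = c00 k := by
  simp [c00, add_mul, mul_assoc, z_mul_x, y_mul_y_mul, add_comm]
theorem c01_mul_x : c01 k * x k = -c01 k := by
  simp [c01, sub_mul, mul_assoc, z_mul_x, y_mul_y_mul, ← smul_neg]
theorem c10_mul_x : c10 k * x k = -c10 k := by
  simp [c10, sub_mul, mul_assoc, z_mul_x, y_mul_y_mul, ← smul_neg]
theorem c11_mul_x : c11 k * x k = c11 k := by
  simp [c11, add_mul, mul_assoc, z_mul_x, y_mul_y_mul, add_comm]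
theorem c00_mul_y : c00 k * y k = c11 k := by
  simp [c00, c11, add_mul, mul_assoc, z_mul_y, y_mul_x_mul]
theorem c01_mul_y : c01 k * y k = c10 k := by
  simp [c01, c10, sub_mul, mul_assoc, z_mul_y, y_mul_x_mul]
theorem c10_mul_y : c10 k * y k = c01 k := by
  simp [c10, c01, sub_mul, mul_assoc, z_mul_y, y_mul_x_mul, x_mul_x_mul]
theorem c11_mul_y : c11 k * y k = c00 k := by
  simp [c11, c00, add_mul, mul_assoc, z_mul_y, y_mul_x_mul, x_mul_x_mul]

variable [NeZero (2 : k)]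

/-- Products of matrix coefficients lie in `k[K]`, so a product of two entries of pairs has only
weight components. These four products give the components of a product of two first entries; the
other entry products follow by inverting a 4×4 sign matrix, so no further products of coefficients
are needed. -/
theorem c00_mul_c00 : c00 k * c00 k = (4 : k)⁻¹ • (1 + x k + y k + x k * y k) := by
  have h2 : (2 : k) ≠ 0 := NeZero.ne 2
  have h4 : (4 : k) = 2 * 2 := by norm_num
  simp [c00, add_mul, mul_add, mul_assoc, z_mul_y_mul, z_mul_z, y_mul_x_mul, x_mul_x_mul,
    mul_sub, x_mul_x, y_mul_y, ← x_mul_y, h4]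
  match_scalars <;> field_simp <;> norm_num
theorem c00_mul_c01 : c00 k * c01 k = (4 : k)⁻¹ • (1 - x k + y k - x k * y k) := by
  have h2 : (2 : k) ≠ 0 := NeZero.ne 2
  have h4 : (4 : k) = 2 * 2 := by norm_num
  simp [c00, c01, add_mul, mul_add, mul_assoc, z_mul_y_mul, z_mul_z, y_mul_x_mul, x_mul_x_mul,
    mul_sub, x_mul_x, y_mul_y, ← x_mul_y, h4]
  match_scalars <;> field_simp <;> norm_num
theorem c01_mul_c00 : c01 k * c00 k = (4 : k)⁻¹ • (1 + x k - y k - x k * y k) := by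
  have h2 : (2 : k) ≠ 0 := NeZero.ne 2
  have h4 : (4 : k) = 2 * 2 := by norm_num
  simp [c00, c01, sub_mul, mul_add, mul_assoc, z_mul_y_mul, z_mul_z, y_mul_x_mul, x_mul_x_mul,
    mul_sub, x_mul_x, y_mul_y, ← x_mul_y, h4]
  match_scalars <;> field_simp <;> norm_num
theorem c01_mul_c01 : c01 k * c01 k = (4 : k)⁻¹ • (-1 + x k + y k - x k * y k) := by
  have h2 : (2 : k) ≠ 0 := NeZero.ne 2
  have h4 : (4 : k) = 2 * 2 := by norm_num
  simp [c01, sub_mul, mul_add, mul_assoc, z_mul_y_mul, z_mul_z, y_mul_x_mul, x_mul_x_mul,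
    mul_sub, x_mul_x, y_mul_y, ← x_mul_y, h4]
  match_scalars <;> field_simp <;> norm_num

theorem comul_c00 : Coalgebra.comul (R := k) (c00 k) = c00 k ⊗ₜ c00 k + c01 k ⊗ₜ c10 k := by
  have h2 : (2 : k) ≠ 0 := NeZero.ne 2
  have e := comul_z k
  rw [← comulZ, comulZ_expand] at e
  simp [c00, c01, c10, comul_y, e, mul_add, mul_sub, y_mul_y_mul, y_mul_x_mul,
    TensorProduct.tmul_add, TensorProduct.add_tmul, TensorProduct.tmul_sub,
    TensorProduct.sub_tmul, ← TensorProduct.smul_tmul']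
  match_scalars <;> field_simp
theorem comul_c01 : Coalgebra.comul (R := k) (c01 k) = c00 k ⊗ₜ c01 k + c01 k ⊗ₜ c11 k := by
  have h2 : (2 : k) ≠ 0 := NeZero.ne 2
  have e := comul_z k
  rw [← comulZ, comulZ_expand] at e
  simp [c00, c01, c11, comul_y, e, mul_add, mul_sub, y_mul_y_mul, y_mul_x_mul,
    TensorProduct.tmul_add, TensorProduct.add_tmul, TensorProduct.tmul_sub,
    TensorProduct.sub_tmul, ← TensorProduct.smul_tmul']
  match_scalars <;> field_simp
-- Left multiplication by the grouplike `x` exchanges the two rows of the matrix, so this row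
-- follows from the other one.
theorem comul_c10 : Coalgebra.comul (R := k) (c10 k) = c10 k ⊗ₜ c00 k + c11 k ⊗ₜ c10 k := by
  rw [← x_mul_c01, Bialgebra.comul_mul, comul_c01, comul_x]
  simp [mul_add, x_mul_c00, x_mul_c01, x_mul_c11, add_comm]
theorem comul_c11 : Coalgebra.comul (R := k) (c11 k) = c10 k ⊗ₜ c01 k + c11 k ⊗ₜ c11 k := by
  rw [← x_mul_c00, Bialgebra.comul_mul, comul_c00, comul_x]
  simp [mul_add, x_mul_c00, x_mul_c01, x_mul_c10, add_comm]
theorem counit_c00 : Coalgebra.counit (R := k) (c00 k) = 1 := by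
  have h2 : (2 : k) ≠ 0 := NeZero.ne 2
  simp [c00, counit_y, counit_z]; field_simp; norm_num
theorem counit_c01 : Coalgebra.counit (R := k) (c01 k) = 0 := by
  simp [c01, counit_y, counit_z]
theorem counit_c10 : Coalgebra.counit (R := k) (c10 k) = 0 := by
  simp [c10, counit_x, counit_y, counit_z]
theorem counit_c11 : Coalgebra.counit (R := k) (c11 k) = 1 := by
  have h2 : (2 : k) ≠ 0 := NeZero.ne 2
  simp [c11, counit_x, counit_y, counit_z]; field_simp; norm_num

end relations
end KP

/-! ### Costable right ideals and semi-invariants. -/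

namespace LeftCoaction
section ideals
variable {k : Type*} [Field k] {H : Type*} [Ring H] [Bialgebra k H]
  {A : Type*} [Ring A] [Algebra k A] (ρ : LeftCoaction k H A)

/-- This reduces costability of a right ideal to a check on its generators. -/
theorem mul_mem_range_lTensor {V : Submodule k A} (hV : ∀ a ∈ V, ∀ b, a * b ∈ V) {s : H ⊗[k] A}
    (hs : s ∈ LinearMap.range (V.subtype.lTensor H)) (t : H ⊗[k] A) :
    s * t ∈ LinearMap.range (V.subtype.lTensor H) := by
  obtain ⟨s, rfl⟩ := hs
  induction s using TensorProduct.induction_on with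
  | zero => simp
  | add a b ha hb => rw [map_add, add_mul]; exact add_mem ha hb
  | tmul h v =>
    induction t using TensorProduct.induction_on with
    | zero => simp
    | add a b ha hb => rw [mul_add]; exact add_mem ha hb
    | tmul g b => exact ⟨(h * g) ⊗ₜ ⟨v.1 * b, hV _ v.2 b⟩, by simp⟩

theorem tmul_mem_range_lTensor {V : Submodule k A} (h : H) {a : A} (ha : a ∈ V) :
    h ⊗ₜ[k] a ∈ LinearMap.range (V.subtype.lTensor H) := ⟨h ⊗ₜ ⟨a, ha⟩, by simp⟩

/-- `a` is a semi-invariant of weight `g`. -/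
def IsWeight (g : H) (a : A) : Prop := ρ.toAlgHom a = g ⊗ₜ a

variable {ρ}

theorem IsWeight.mul {g h : H} {a b : A} (ha : ρ.IsWeight g a) (hb : ρ.IsWeight h b) :
    ρ.IsWeight (g * h) (a * b) := by
  rw [IsWeight, map_mul, ha, hb, Algebra.TensorProduct.tmul_mul_tmul]

theorem IsWeight.add {g : H} {a b : A} (ha : ρ.IsWeight g a) (hb : ρ.IsWeight g b) :
    ρ.IsWeight g (a + b) := by
  rw [IsWeight, map_add, ha, hb, TensorProduct.tmul_add]

theorem IsWeight.smul {g : H} {a : A} (ha : ρ.IsWeight g a) (r : k) : ρ.IsWeight g (r • a) := by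
  rw [IsWeight, map_smul, ha, TensorProduct.tmul_smul]

theorem isWeight_zero (g : H) : ρ.IsWeight g 0 := by simp [IsWeight]

theorem isWeight_one : ρ.IsWeight 1 (1 : A) := by
  rw [IsWeight, map_one]; rfl

theorem IsAMExact.exists_eq_smul_one (hρ : ρ.IsAMExact) {a : A} (ha : ρ.IsWeight 1 a) :
    ∃ r : k, a = r • 1 := by
  have : a ∈ ρ.coinvariants := ha
  rw [hρ.coinvariants_eq_bot, Algebra.mem_bot] at this
  obtain ⟨r, rfl⟩ := this
  exact ⟨r, Algebra.algebraMap_eq_smul_one r⟩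

/-- The right ideal `a A` is costable because its generator is a semi-invariant; being nonzero, it
contains 1. -/
theorem IsAMExact.exists_right_inverse (hρ : ρ.IsAMExact) {g : H} {a : A} (ha : ρ.IsWeight g a)
    (h0 : a ≠ 0) : ∃ b, a * b = 1 := by
  let V : Submodule k A := LinearMap.range (LinearMap.mulLeft k a)
  have hV : ∀ c ∈ V, ∀ b, c * b ∈ V := by
    rintro _ ⟨c, rfl⟩ b
    exact ⟨c * b, by simp [mul_assoc]⟩
  have haV : a ∈ V := ⟨1, by simp⟩
  have hc : ρ.IsCostable V := by
    rintro _ ⟨c, rfl⟩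
    rw [LinearMap.mulLeft_apply, map_mul]
    refine mul_mem_range_lTensor hV ?_ _
    rw [ha]
    exact tmul_mem_range_lTensor g haV
  rcases hρ.isRightSimple.eq_bot_or_eq_top V hV hc with h | h
  · rw [h, Submodule.mem_bot] at haV
    exact absurd haV h0
  · have : (1 : A) ∈ V := h ▸ Submodule.mem_top
    obtain ⟨b, hb⟩ := this
    exact ⟨b, hb⟩

/-- The square of `a` has weight 1, so it is a scalar, and it is nonzero because `a` has a right
inverse; dividing by a square root gives `u`. Multiplication by `u` carries the weight space of `g`
into the scalars, so that space is a line. -/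
theorem IsAMExact.exists_normalized [IsAlgClosed k] (hρ : ρ.IsAMExact) {g : H} (hg : g * g = 1)
    {a : A} (ha : ρ.IsWeight g a) (h0 : a ≠ 0) :
    ∃ u : A, ρ.IsWeight g u ∧ u * u = 1 ∧ ∀ b, ρ.IsWeight g b → ∃ r : k, b = r • u := by
  obtain ⟨b, hb⟩ := hρ.exists_right_inverse ha h0
  obtain ⟨r, hr⟩ := hρ.exists_eq_smul_one (hg ▸ ha.mul ha)
  have hr0 : r ≠ 0 := by
    rintro rfl
    apply h0
    calc a = a * a * b := by rw [mul_assoc, hb, mul_one]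
      _ = 0 := by rw [hr]; simp
  obtain ⟨s, hs⟩ := IsAlgClosed.exists_pow_nat_eq r (n := 2) (by norm_num)
  have hs0 : s ≠ 0 := by rintro rfl; simp at hs; exact hr0 hs.symm
  have hu : (s⁻¹ • a) * (s⁻¹ • a) = 1 := by
    rw [smul_mul_smul_comm, hr, smul_smul, ← hs]
    convert one_smul k (1 : A)
    field_simp
  refine ⟨s⁻¹ • a, ha.smul _, hu, fun b hb => ?_⟩
  obtain ⟨t, ht⟩ := hρ.exists_eq_smul_one (hg ▸ (ha.smul s⁻¹).mul hb)
  refine ⟨t, ?_⟩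
  calc b = (s⁻¹ • a) * ((s⁻¹ • a) * b) := by rw [← mul_assoc, hu, one_mul]
    _ = t • s⁻¹ • a := by rw [ht, mul_smul_comm, mul_one]

end ideals
end LeftCoaction

/-! ### Components of products of pairs, and the operators given by semi-invariants. -/

namespace KP
section operators
variable (k : Type*) [Field k] {A : Type*} [Ring A] [Algebra k A]

/-- The components of the products of the entries of two pairs. -/
def beta1 (v w : A × A) : A :=
  (4 : k)⁻¹ • (v.1 * w.1 + v.1 * w.2 + v.2 * w.1 - v.2 * w.2)
-- The signs in the four components are those of x, y, xy and 1 in the products `c00 * c00`, `c00 *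
-- c01`, `c01 * c00` and `c01 * c01`.
def betax (v w : A × A) : A :=
  (4 : k)⁻¹ • (v.1 * w.1 - v.1 * w.2 + v.2 * w.1 + v.2 * w.2)
def betay (v w : A × A) : A :=
  (4 : k)⁻¹ • (v.1 * w.1 + v.1 * w.2 - v.2 * w.1 + v.2 * w.2)
def betaxy (v w : A × A) : A :=
  (4 : k)⁻¹ • (v.1 * w.1 - v.1 * w.2 - v.2 * w.1 - v.2 * w.2)

/-- The left and right actions of semi-invariants on pairs. -/
def leftX (a : A) : (A × A) →ₗ[k] (A × A) where
  toFun v := (a * v.2, a * v.1)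
  map_add' v w := by simp [mul_add]
  map_smul' r v := by simp
-- Multiplication by a grouplike permutes the matrix coefficients up to sign. The swaps and signs in
-- these six operators compensate for this, so that each operator preserves `pairs` when its element
-- has the corresponding weight.
def leftY (a : A) : (A × A) →ₗ[k] (A × A) where
  toFun v := (a * v.1, -(a * v.2))
  map_add' v w := by ext <;> simp [mul_add]; abel
  map_smul' r v := by simp
def leftXY (a : A) : (A × A) →ₗ[k] (A × A) where
  toFun v := (-(a * v.2), a * v.1)
  map_add' v w := by ext <;> simp [mul_add]; abel
  map_smul' r v := by simp
def rightX (a : A) : (A × A) →ₗ[k] (A × A) where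
  toFun v := (v.1 * a, -(v.2 * a))
  map_add' v w := by ext <;> simp [add_mul]; abel
  map_smul' r v := by simp
def rightY (a : A) : (A × A) →ₗ[k] (A × A) where
  toFun v := (v.2 * a, v.1 * a)
  map_add' v w := by simp [add_mul]
  map_smul' r v := by simp
def rightXY (a : A) : (A × A) →ₗ[k] (A × A) where
  toFun v := (-(v.2 * a), v.1 * a)
  map_add' v w := by ext <;> simp [add_mul]; abel
  map_smul' r v := by simp

theorem leftX_apply (a : A) (v : A × A) : leftX k a v = (a * v.2, a * v.1) := rfl
theorem leftY_apply (a : A) (v : A × A) : leftY k a v = (a * v.1, -(a * v.2)) := rfl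
theorem leftXY_apply (a : A) (v : A × A) : leftXY k a v = (-(a * v.2), a * v.1) := rfl
theorem rightX_apply (a : A) (v : A × A) : rightX k a v = (v.1 * a, -(v.2 * a)) := rfl
theorem rightY_apply (a : A) (v : A × A) : rightY k a v = (v.2 * a, v.1 * a) := rfl
theorem rightXY_apply (a : A) (v : A × A) : rightXY k a v = (-(v.2 * a), v.1 * a) := rfl

variable {k}

variable (k) in
/-- The bilinear form on pairs that is given by the invariant part of the product. -/
noncomputable def form (τ : A →ₗ[k] k) : (A × A) →ₗ[k] (A × A) →ₗ[k] k :=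
  LinearMap.mk₂ k (fun v w => τ (beta1 k v w))
    (fun v v' w => by
      rw [← map_add]
      congr 1
      simp only [beta1, Prod.fst_add, Prod.snd_add, add_mul]
      module)
    (fun r v w => by
      rw [← map_smul]
      congr 1
      simp only [beta1, Prod.smul_fst, Prod.smul_snd, smul_mul_assoc]
      module)
    (fun v w w' => by
      rw [← map_add]
      congr 1
      simp only [beta1, Prod.fst_add, Prod.snd_add, mul_add]
      module)
    (fun r v w => by
      rw [← map_smul]
      congr 1
      simp only [beta1, Prod.smul_fst, Prod.smul_snd, mul_smul_comm]
      module)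

theorem form_apply (τ : A →ₗ[k] k) (v w : A × A) : form k τ v w = τ (beta1 k v w) := rfl

/-- Multiplying by an element of weight g moves the component of weight g into the invariant one,
since g has order two. All components can thus be expressed through the invariant form. -/
theorem beta1_leftX (a : A) (v w : A × A) : beta1 k (leftX k a v) w = a * betax k v w := by
  simp only [leftX_apply, beta1, betax, mul_smul_comm, mul_add, mul_sub, mul_assoc]
  congr 1; abel
theorem beta1_leftY (a : A) (v w : A × A) : beta1 k (leftY k a v) w = a * betay k v w := by
  simp only [leftY_apply, beta1, betay, mul_smul_comm, mul_add, mul_sub, mul_assoc, neg_mul]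
  congr 1; abel
theorem beta1_leftXY (a : A) (v w : A × A) : beta1 k (leftXY k a v) w = a * betaxy k v w := by
  simp only [leftXY_apply, beta1, betaxy, mul_smul_comm, mul_sub, mul_assoc, neg_mul]
  congr 1; abel
theorem beta1_rightY (a : A) (v w : A × A) : beta1 k v (rightY k a w) = betay k v w * a := by
  simp only [rightY_apply, beta1, betay, smul_mul_assoc, add_mul, sub_mul, mul_assoc]
  congr 1; abel
theorem beta1_rightXY (a : A) (v w : A × A) : beta1 k v (rightXY k a w) = betaxy k v w * a := by
  simp only [rightXY_apply, beta1, betaxy, smul_mul_assoc, sub_mul, mul_assoc, mul_neg]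
  congr 1; abel
-- This is `(v a) w = v (a w)` on invariant components.
theorem beta1_balanced_x (a : A) (v w : A × A) :
    beta1 k (rightX k a v) w = beta1 k v (leftX k a w) := by
  simp only [rightX_apply, leftX_apply, beta1, mul_assoc, neg_mul]
  congr 1; abel
end operators

/-! ### Isotypic decomposition and the nondegenerate form on pairs. -/

section pairs
open LeftCoaction
variable {k : Type*} [Field k] [NeZero (2 : k)] {A : Type*} [Ring A] [Algebra k A]
  (ρ : LeftCoaction k (KP k) A)

/-- The pairs `(v₀, v₁)` such that `z ↦ v₀`, `x z ↦ v₁` is a morphism of comodules. -/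
noncomputable def pairs : Submodule k (A × A) where
  carrier := {v | ρ.toAlgHom v.1 = c00 k ⊗ₜ v.1 + c01 k ⊗ₜ v.2 ∧
    ρ.toAlgHom v.2 = c10 k ⊗ₜ v.1 + c11 k ⊗ₜ v.2}
  add_mem' := by
    rintro v w ⟨h1, h2⟩ ⟨h3, h4⟩
    constructor <;> simp only [Prod.fst_add, Prod.snd_add, map_add, TensorProduct.tmul_add, *] <;>
      abel
  zero_mem' := by simp
  smul_mem' := by
    rintro r v ⟨h1, h2⟩
    constructor <;> simp [h1, h2]

variable {ρ}

/-- Comparing coefficients in the coassociativity identity shows that each row of coefficients of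
`λ(a)` is a pair and each grouplike coefficient is a semi-invariant. The counit, which is 1 on
grouplikes and on `c00`, `c11` and 0 on `c01`, `c10`, recovers `a`. -/
theorem components {a p1 px py pxy q00 q01 q10 q11 : A}
    (h : ρ.toAlgHom a = comb p1 px py pxy q00 q01 q10 q11) :
    ρ.IsWeight 1 p1 ∧ ρ.IsWeight (x k) px ∧ ρ.IsWeight (y k) py ∧ ρ.IsWeight (x k * y k) pxy ∧
    (q00, q01) ∈ pairs ρ ∧ (q10, q11) ∈ pairs ρ ∧ a = p1 + px + py + pxy + (q00 + q11) := by
  have h1 := ρ.coassoc a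
  have h2 := ρ.counit a
  rw [h] at h1 h2
  have e1 : Algebra.TensorProduct.assoc k k k (KP k) (KP k) A
      (Algebra.TensorProduct.map (Bialgebra.comulAlgHom k (KP k)) (AlgHom.id k A)
        (comb p1 px py pxy q00 q01 q10 q11)) =
      comb (1 ⊗ₜ p1) (x k ⊗ₜ px) (y k ⊗ₜ py) ((x k * y k) ⊗ₜ pxy)
        (c00 k ⊗ₜ q00 + c01 k ⊗ₜ q01) (c10 k ⊗ₜ q00 + c11 k ⊗ₜ q01)
        (c00 k ⊗ₜ q10 + c01 k ⊗ₜ q11) (c10 k ⊗ₜ q10 + c11 k ⊗ₜ q11) := by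
    simp only [comb, map_add, Algebra.TensorProduct.map_tmul, Bialgebra.comulAlgHom_apply,
      Bialgebra.comul_one, Bialgebra.comul_mul, comul_x, comul_y, comul_c00, comul_c01, comul_c10,
      comul_c11, AlgHom.id_apply, TensorProduct.add_tmul, TensorProduct.tmul_add,
      Algebra.TensorProduct.assoc_tmul, Algebra.TensorProduct.one_def,
      Algebra.TensorProduct.tmul_mul_tmul]
    abel
  have e2 : Algebra.TensorProduct.map (AlgHom.id k (KP k)) ρ.toAlgHom
      (comb p1 px py pxy q00 q01 q10 q11) =
      comb (ρ.toAlgHom p1) (ρ.toAlgHom px) (ρ.toAlgHom py) (ρ.toAlgHom pxy) (ρ.toAlgHom q00)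
        (ρ.toAlgHom q01) (ρ.toAlgHom q10) (ρ.toAlgHom q11) := by
    simp [comb]
  rw [e1, e2] at h1
  obtain ⟨i1, i2, i3, i4, i5, i6, i7, i8⟩ := comb_inj h1
  refine ⟨i1.symm, i2.symm, i3.symm, i4.symm, ⟨i5.symm, i6.symm⟩, ⟨i7.symm, i8.symm⟩, ?_⟩
  rw [← h2]
  simp [comb, counit_x, counit_y, counit_c00, counit_c01, counit_c10, counit_c11]

variable (ρ) in
theorem exists_components (a : A) : ∃ p1 px py pxy : A, ∃ v w : A × A,
    ρ.IsWeight 1 p1 ∧ ρ.IsWeight (x k) px ∧ ρ.IsWeight (y k) py ∧ ρ.IsWeight (x k * y k) pxy ∧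
    v ∈ pairs ρ ∧ w ∈ pairs ρ ∧ a = p1 + px + py + pxy + (v.1 + w.2) := by
  obtain ⟨p1, px, py, pxy, q00, q01, q10, q11, h⟩ := exists_comb (ρ.toAlgHom a)
  exact ⟨p1, px, py, pxy, (q00, q01), (q10, q11), components h⟩

/-- The coaction reveals both entries of each pair: `v` appears at `c00`, `c01` and `w` at `c10`,
`c11`. First entries and second entries thus occupy independent slots of `A`, which is how
associativity is exploited later. -/
theorem components_eq_zero {p1 px py pxy : A} {v w : A × A} (h1 : ρ.IsWeight 1 p1)
    (hx : ρ.IsWeight (x k) px) (hy : ρ.IsWeight (y k) py) (hxy : ρ.IsWeight (x k * y k) pxy)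
    (hv : v ∈ pairs ρ) (hw : w ∈ pairs ρ) (h : p1 + px + py + pxy + (v.1 + w.2) = 0) :
    p1 = 0 ∧ px = 0 ∧ py = 0 ∧ pxy = 0 ∧ v = 0 ∧ w = 0 := by
  have e := congrArg ρ.toAlgHom h
  simp only [map_add, map_zero] at e
  rw [h1, hx, hy, hxy, hv.1, hw.2] at e
  have : comb (k := k) p1 px py pxy v.1 v.2 w.1 w.2 = 0 := by
    rw [← e, comb]; abel
  obtain ⟨i1, i2, i3, i4, i5, i6, i7, i8⟩ := comb_eq_zero this
  exact ⟨i1, i2, i3, i4, Prod.ext i5 i6, Prod.ext i7 i8⟩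

theorem pairs_eq_zero {v w : A × A} (hv : v ∈ pairs ρ) (hw : w ∈ pairs ρ) (h : v.1 + w.2 = 0) :
    v = 0 ∧ w = 0 := by
  have := components_eq_zero (ρ := ρ) (isWeight_zero 1) (isWeight_zero _) (isWeight_zero _)
    (isWeight_zero _) hv hw (by simpa using h)
  exact this.2.2.2.2

theorem pairs_inj {v w v' w' : A × A} (hv : v ∈ pairs ρ) (hw : w ∈ pairs ρ) (hv' : v' ∈ pairs ρ)
    (hw' : w' ∈ pairs ρ) (h : v.1 + w.2 = v'.1 + w'.2) : v = v' ∧ w = w' := by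
  have := pairs_eq_zero (sub_mem hv hv') (sub_mem hw hw') (by
    simp only [Prod.fst_sub, Prod.snd_sub]
    rw [← sub_eq_zero] at h
    rw [← h]; abel)
  simpa only [sub_eq_zero] using this

section products

theorem quarter (a : A) : (4 : k)⁻¹ • ((4 : k) • a) = a := by
  have h2 : (2 : k) ≠ 0 := NeZero.ne 2
  have h4 : (4 : k) ≠ 0 := by
    have : (4 : k) = 2 * 2 := by norm_num
    rw [this]; exact mul_ne_zero h2 h2
  rw [smul_smul, inv_mul_cancel₀ h4, one_smul]

/-- The sign matrix that defines the four components has orthogonal rows, so its inverse is a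
quarter of its transpose. -/
theorem fst_mul_fst (v w : A × A) :
    v.1 * w.1 = beta1 k v w + betax k v w + betay k v w + betaxy k v w := by
  simp only [beta1, betax, betay, betaxy, ← smul_add]
  refine (quarter (k := k) _).symm.trans ?_
  congr 1; module
theorem fst_mul_snd (v w : A × A) :
    v.1 * w.2 = beta1 k v w - betax k v w + betay k v w - betaxy k v w := by
  simp only [beta1, betax, betay, betaxy, ← smul_add, ← smul_sub]
  refine (quarter (k := k) _).symm.trans ?_
  congr 1; module
theorem snd_mul_fst (v w : A × A) :
    v.2 * w.1 = beta1 k v w + betax k v w - betay k v w - betaxy k v w := by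
  simp only [beta1, betax, betay, betaxy, ← smul_add, ← smul_sub]
  refine (quarter (k := k) _).symm.trans ?_
  congr 1; module
theorem snd_mul_snd (v w : A × A) :
    v.2 * w.2 = -beta1 k v w + betax k v w + betay k v w - betaxy k v w := by
  simp only [beta1, betax, betay, betaxy, ← smul_add, ← smul_sub, ← smul_neg]
  refine (quarter (k := k) _).symm.trans ?_
  congr 1; module

theorem isWeight_beta {v w : A × A} (hv : v ∈ pairs ρ) (hw : w ∈ pairs ρ) :
    ρ.IsWeight 1 (beta1 k v w) ∧ ρ.IsWeight (x k) (betax k v w) ∧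
    ρ.IsWeight (y k) (betay k v w) ∧ ρ.IsWeight (x k * y k) (betaxy k v w) := by
  have h : ρ.toAlgHom (v.1 * w.1) = comb (beta1 k v w) (betax k v w) (betay k v w)
      (betaxy k v w) 0 0 0 0 := by
    rw [map_mul, hv.1, hw.1]
    simp only [comb, beta1, betax, betay, betaxy, add_mul, mul_add,
      Algebra.TensorProduct.tmul_mul_tmul, c00_mul_c00, c00_mul_c01, c01_mul_c00, c01_mul_c01,
      TensorProduct.tmul_zero, TensorProduct.tmul_smul, ← TensorProduct.smul_tmul',
      TensorProduct.tmul_add, TensorProduct.tmul_sub, TensorProduct.add_tmul,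
      TensorProduct.sub_tmul, TensorProduct.neg_tmul]
    module
  have := components h
  exact ⟨this.1, this.2.1, this.2.2.1, this.2.2.2.1⟩

end products

section operators

theorem map_left_mul {g : KP k} {a : A} (ha : ρ.IsWeight g a) {v : A × A} (hv : v ∈ pairs ρ) :
    ρ.toAlgHom (a * v.1) = (g * c00 k) ⊗ₜ (a * v.1) + (g * c01 k) ⊗ₜ (a * v.2) ∧
    ρ.toAlgHom (a * v.2) = (g * c10 k) ⊗ₜ (a * v.1) + (g * c11 k) ⊗ₜ (a * v.2) := by
  constructor <;> rw [map_mul, ha]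
  · rw [hv.1, mul_add]; simp
  · rw [hv.2, mul_add]; simp

theorem map_right_mul {g : KP k} {a : A} (ha : ρ.IsWeight g a) {v : A × A} (hv : v ∈ pairs ρ) :
    ρ.toAlgHom (v.1 * a) = (c00 k * g) ⊗ₜ (v.1 * a) + (c01 k * g) ⊗ₜ (v.2 * a) ∧
    ρ.toAlgHom (v.2 * a) = (c10 k * g) ⊗ₜ (v.1 * a) + (c11 k * g) ⊗ₜ (v.2 * a) := by
  constructor <;> rw [map_mul, ha]
  · rw [hv.1, add_mul]; simp
  · rw [hv.2, add_mul]; simp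

theorem leftX_mem {a : A} (ha : ρ.IsWeight (x k) a) {v : A × A} (hv : v ∈ pairs ρ) :
    leftX k a v ∈ pairs ρ := by
  have h := map_left_mul ha hv
  simp only [x_mul_c00, x_mul_c01, x_mul_c10, x_mul_c11] at h
  exact ⟨h.2.trans (add_comm _ _), h.1.trans (add_comm _ _)⟩

theorem leftY_mem {a : A} (ha : ρ.IsWeight (y k) a) {v : A × A} (hv : v ∈ pairs ρ) :
    leftY k a v ∈ pairs ρ := by
  have h := map_left_mul ha hv
  simp only [y_mul_c00, y_mul_c01, y_mul_c10, y_mul_c11] at h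
  constructor
  · simpa [leftY_apply, TensorProduct.neg_tmul, TensorProduct.tmul_neg] using h.1
  · simp [leftY_apply, TensorProduct.neg_tmul, TensorProduct.tmul_neg, h.2, add_comm]

theorem leftXY_mem {a : A} (ha : ρ.IsWeight (x k * y k) a) {v : A × A} (hv : v ∈ pairs ρ) :
    leftXY k a v ∈ pairs ρ := by
  have h := map_left_mul ha hv
  simp only [mul_assoc, y_mul_c00, y_mul_c01, y_mul_c10, y_mul_c11, mul_neg, x_mul_c00,
    x_mul_c01, x_mul_c10, x_mul_c11] at h
  constructor
  · simp [leftXY_apply, TensorProduct.neg_tmul, TensorProduct.tmul_neg, h.2, add_comm]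
  · simp [leftXY_apply, TensorProduct.neg_tmul, TensorProduct.tmul_neg, h.1, add_comm]

theorem rightX_mem {a : A} (ha : ρ.IsWeight (x k) a) {v : A × A} (hv : v ∈ pairs ρ) :
    rightX k a v ∈ pairs ρ := by
  have h := map_right_mul ha hv
  simp only [c00_mul_x, c01_mul_x, c10_mul_x, c11_mul_x] at h
  constructor
  · simpa [rightX_apply, TensorProduct.neg_tmul, TensorProduct.tmul_neg] using h.1
  · simp [rightX_apply, TensorProduct.neg_tmul, TensorProduct.tmul_neg, h.2, add_comm]

theorem rightY_mem {a : A} (ha : ρ.IsWeight (y k) a) {v : A × A} (hv : v ∈ pairs ρ) :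
    rightY k a v ∈ pairs ρ := by
  have h := map_right_mul ha hv
  simp only [c00_mul_y, c01_mul_y, c10_mul_y, c11_mul_y] at h
  exact ⟨h.2.trans (add_comm _ _), h.1.trans (add_comm _ _)⟩

theorem rightXY_mem {a : A} (ha : ρ.IsWeight (x k * y k) a) {v : A × A} (hv : v ∈ pairs ρ) :
    rightXY k a v ∈ pairs ρ := by
  have h := map_right_mul ha hv
  simp only [← mul_assoc, c00_mul_x, c01_mul_x, c10_mul_x, c11_mul_x, neg_mul, c00_mul_y,
    c01_mul_y, c10_mul_y, c11_mul_y] at h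
  constructor
  · simp [rightXY_apply, TensorProduct.neg_tmul, TensorProduct.tmul_neg, h.2, add_comm]
  · simp [rightXY_apply, TensorProduct.neg_tmul, TensorProduct.tmul_neg, h.1, add_comm]

end operators

section form

theorem beta1_eq (hρ : ρ.IsAMExact) {τ : A →ₗ[k] k} (hτ : τ 1 = 1) {v w : A × A}
    (hv : v ∈ pairs ρ) (hw : w ∈ pairs ρ) : beta1 k v w = form k τ v w • (1 : A) := by
  obtain ⟨r, hr⟩ := hρ.exists_eq_smul_one (isWeight_beta hv hw).1
  rw [form_apply, hr, map_smul, hτ, smul_eq_mul, mul_one]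

theorem weight_parts_ne {px py pxy : A} {v w : A × A}
    (hx : ρ.IsWeight (x k) px) (hy : ρ.IsWeight (y k) py) (hxy : ρ.IsWeight (x k * y k) pxy)
    (hv : v ∈ pairs ρ) (hw : w ∈ pairs ρ) [Nontrivial A] :
    px + py + pxy + (v.1 + w.2) ≠ 1 := by
  intro h
  have := components_eq_zero (ρ := ρ) (isWeight_one.smul (-1)) hx hy hxy hv hw (by
    have e : (-1 : k) • (1 : A) + px + py + pxy + (v.1 + w.2) =
        px + py + pxy + (v.1 + w.2) - 1 := by module
    rw [e, h, sub_self])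
  simpa using this.1

/-- Elements whose invariant component vanishes. -/
def noninvariant (ρ : LeftCoaction k (KP k) A) : Submodule k A where
  carrier := {a | ∃ px py pxy : A, ∃ v w : A × A, ρ.IsWeight (x k) px ∧ ρ.IsWeight (y k) py ∧
    ρ.IsWeight (x k * y k) pxy ∧ v ∈ pairs ρ ∧ w ∈ pairs ρ ∧ a = px + py + pxy + (v.1 + w.2)}
  add_mem' := by
    rintro _ _ ⟨px, py, pxy, v, w, h1, h2, h3, h4, h5, rfl⟩
      ⟨px', py', pxy', v', w', h1', h2', h3', h4', h5', rfl⟩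
    refine ⟨_, _, _, _, _, h1.add h1', h2.add h2', h3.add h3', add_mem h4 h4', add_mem h5 h5', ?_⟩
    simp only [Prod.fst_add, Prod.snd_add]; abel
  zero_mem' := ⟨0, 0, 0, 0, 0, isWeight_zero _, isWeight_zero _, isWeight_zero _,
    zero_mem _, zero_mem _, by simp⟩
  smul_mem' := by
    rintro r _ ⟨px, py, pxy, v, w, h1, h2, h3, h4, h5, rfl⟩
    exact ⟨_, _, _, _, _, h1.smul r, h2.smul r, h3.smul r, Submodule.smul_mem _ r h4,
      Submodule.smul_mem _ r h5, by simp⟩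

theorem one_notMem_noninvariant [Nontrivial A] : (1 : A) ∉ noninvariant ρ := by
  rintro ⟨px, py, pxy, v, w, h1, h2, h3, h4, h5, h⟩
  exact weight_parts_ne h1 h2 h3 h4 h5 h.symm

theorem mem_noninvariant_x {a : A} (h : ρ.IsWeight (x k) a) : a ∈ noninvariant ρ :=
  ⟨a, 0, 0, 0, 0, h, isWeight_zero _, isWeight_zero _, zero_mem _, zero_mem _, by simp⟩
theorem mem_noninvariant_y {a : A} (h : ρ.IsWeight (y k) a) : a ∈ noninvariant ρ :=
  ⟨0, a, 0, 0, 0, isWeight_zero _, h, isWeight_zero _, zero_mem _, zero_mem _, by simp⟩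
theorem mem_noninvariant_xy {a : A} (h : ρ.IsWeight (x k * y k) a) : a ∈ noninvariant ρ :=
  ⟨0, 0, a, 0, 0, isWeight_zero _, isWeight_zero _, h, zero_mem _, zero_mem _, by simp⟩
theorem fst_mem_noninvariant {v : A × A} (h : v ∈ pairs ρ) : v.1 ∈ noninvariant ρ :=
  ⟨0, 0, 0, v, 0, isWeight_zero _, isWeight_zero _, isWeight_zero _, h, zero_mem _, by simp⟩
theorem snd_mem_noninvariant {v : A × A} (h : v ∈ pairs ρ) : v.2 ∈ noninvariant ρ :=
  ⟨0, 0, 0, 0, v, isWeight_zero _, isWeight_zero _, isWeight_zero _, zero_mem _, h, by simp⟩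

/-- A semi-invariant carries `v` to another pair up to sign and order of entries, while a product of
`v` with a pair has only the components x, y, xy once the invariant one vanishes. -/
theorem mul_mem_noninvariant (hρ : ρ.IsAMExact) {v : A × A} (hv : v ∈ pairs ρ)
    (h : ∀ w ∈ pairs ρ, beta1 k v w = 0) (a : A) :
    v.1 * a ∈ noninvariant ρ ∧ v.2 * a ∈ noninvariant ρ := by
  obtain ⟨p1, px, py, pxy, u, w, h1, hx, hy, hxy, hu, hw, rfl⟩ := exists_components ρ a
  obtain ⟨r, rfl⟩ := hρ.exists_eq_smul_one h1
  have ix := rightX_mem hx hv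
  have iy := rightY_mem hy hv
  have ixy := rightXY_mem hxy hv
  have bu := isWeight_beta hv hu
  have bw := isWeight_beta hv hw
  have bxu := mem_noninvariant_x bu.2.1
  have byu := mem_noninvariant_y bu.2.2.1
  have bxyu := mem_noninvariant_xy bu.2.2.2
  have bxw := mem_noninvariant_x bw.2.1
  have byw := mem_noninvariant_y bw.2.2.1
  have bxyw := mem_noninvariant_xy bw.2.2.2
  simp only [mul_add, mul_smul_comm, mul_one, fst_mul_fst (k := k), fst_mul_snd (k := k),
    snd_mul_fst (k := k), snd_mul_snd (k := k), h u hu, h w hw]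
  constructor
  · refine add_mem (add_mem (add_mem (add_mem (Submodule.smul_mem _ _ (fst_mem_noninvariant hv))
      (fst_mem_noninvariant ix)) (snd_mem_noninvariant iy)) (snd_mem_noninvariant ixy))
      (add_mem ?_ ?_)
    · exact add_mem (add_mem (add_mem (zero_mem _) bxu) byu) bxyu
    · exact sub_mem (add_mem (sub_mem (zero_mem _) bxw) byw) bxyw
  · have e1 : v.2 * px = -(rightX k px v).2 := by simp [rightX_apply]
    have e2 : v.2 * pxy = -(rightXY k pxy v).1 := by simp [rightXY_apply]
    rw [e1, e2]
    refine add_mem (add_mem (add_mem (add_mem (Submodule.smul_mem _ _ (snd_mem_noninvariant hv))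
      (neg_mem (snd_mem_noninvariant ix))) (fst_mem_noninvariant iy))
      (neg_mem (fst_mem_noninvariant ixy))) (add_mem ?_ ?_)
    · exact sub_mem (sub_mem (add_mem (zero_mem _) bxu) byu) bxyu
    · exact sub_mem (add_mem (add_mem (neg_mem (zero_mem _)) bxw) byw) bxyw

/-- The right ideal `v.1 A + v.2 A` is costable and nonzero, hence contains 1. If `v` were
orthogonal to all pairs, every element of this ideal would lack an invariant component, which 1 does
not. -/
theorem exists_beta1_ne_zero (hρ : ρ.IsAMExact) {v : A × A} (hv : v ∈ pairs ρ) (h0 : v ≠ 0) :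
    ∃ w ∈ pairs ρ, beta1 k v w ≠ 0 := by
  by_contra! h
  have hn := hρ.isRightSimple.nontrivial
  let V : Submodule k A := LinearMap.range (LinearMap.mulLeft k v.1) ⊔
    LinearMap.range (LinearMap.mulLeft k v.2)
  have hV : ∀ c ∈ V, ∀ b, c * b ∈ V := by
    intro c hc b
    obtain ⟨_, ⟨c, rfl⟩, _, ⟨d, rfl⟩, rfl⟩ := Submodule.mem_sup.1 hc
    refine Submodule.mem_sup.2 ⟨_, ⟨c * b, rfl⟩, _, ⟨d * b, rfl⟩, ?_⟩
    simp [add_mul, mul_assoc]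
  have m1 : v.1 ∈ V := Submodule.mem_sup_left ⟨1, by simp⟩
  have m2 : v.2 ∈ V := Submodule.mem_sup_right ⟨1, by simp⟩
  have hc : ρ.IsCostable V := by
    intro c hc
    obtain ⟨_, ⟨c, rfl⟩, _, ⟨d, rfl⟩, rfl⟩ := Submodule.mem_sup.1 hc
    simp only [LinearMap.mulLeft_apply]
    rw [map_add, map_mul, map_mul, hv.1, hv.2]
    refine add_mem (mul_mem_range_lTensor hV ?_ _) (mul_mem_range_lTensor hV ?_ _) <;>
      exact add_mem (tmul_mem_range_lTensor _ m1) (tmul_mem_range_lTensor _ m2)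
  rcases hρ.isRightSimple.eq_bot_or_eq_top V hV hc with e | e
  · rw [e, Submodule.mem_bot] at m1 m2
    exact h0 (Prod.ext m1 m2)
  · have : (1 : A) ∈ V := e ▸ Submodule.mem_top
    obtain ⟨_, ⟨c, rfl⟩, _, ⟨d, rfl⟩, h1⟩ := Submodule.mem_sup.1 this
    apply one_notMem_noninvariant (ρ := ρ)
    rw [← h1]
    exact add_mem (mul_mem_noninvariant hρ hv h c).1 (mul_mem_noninvariant hρ hv h d).2

end form
end pairs
end KP

/-! ### Linear algebra of the associativity constraints. -/

section linearAlgebra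
variable {k : Type*} [Field k] {E : Type*} [AddCommGroup E] [Module k E]

/-- A nondegenerate form with `b(w, u) v = b(v, w) u` lives on a line. -/
theorem eq_of_form_adjoint {T : Submodule k E} {b : E →ₗ[k] E →ₗ[k] k} {Z Z' : E →ₗ[k] E}
    (hZT : ∀ v ∈ T, Z v ∈ T) (hZ'T : ∀ v ∈ T, Z' v ∈ T)
    (hb : ∀ v ∈ T, v ≠ 0 → ∃ w ∈ T, b v w ≠ 0)
    (hbZ : ∀ v ∈ T, ∀ w ∈ T, b (Z v) w = b v (Z' w))
    (hassoc : ∀ v ∈ T, ∀ w ∈ T, ∀ u ∈ T, b w u • v = b v w • u) :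
    ∀ v ∈ T, Z v = Z' v := by
  intro v hv
  by_cases h0 : v = 0
  · simp [h0]
  obtain ⟨w, hw, hvw⟩ := hb v hv h0
  have hline : ∀ u ∈ T, ∃ r : k, u = r • v := fun u hu =>
    ⟨(b v w)⁻¹ * b w u, by
      rw [mul_smul, hassoc v hv w hw u hu, smul_smul, inv_mul_cancel₀ hvw, one_smul]⟩
  obtain ⟨μ, hμ⟩ := hline _ (hZT v hv)
  obtain ⟨ν, hν⟩ := hline _ (hZ'T v hv)
  obtain ⟨r, rfl⟩ := hline w hw
  -- On the line both operators are scalars. Adjointness at `(v, v)` equates them, since `b v v ≠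
  -- 0`: the witness `w` of nondegeneracy is itself a multiple of `v`.
  have := hbZ v hv v hv
  rw [hμ, hν] at this
  simp only [map_smul, LinearMap.smul_apply, smul_eq_mul] at this hvw
  rw [hμ, hν, mul_right_cancel₀ (right_ne_zero_of_mul hvw) this]

variable [NeZero (2 : k)]

/-- Either `v + P v` is a nonzero fixed vector, or `P v = -v` and `v - P v = 2 v`. The eigenvector
is kept in the explicit form `v + μ • P v` so that an operator commuting with `P` preserves
eigenvectors already found. -/
theorem exists_eigenvector_of_involution {T : Submodule k E} {P : E →ₗ[k] E}
    (hT : ∀ v ∈ T, P v ∈ T) (hP : ∀ v, P (P v) = v) {v : E} (hv : v ∈ T) (h0 : v ≠ 0) :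
    ∃ μ : k, μ * μ = 1 ∧ v + μ • P v ∈ T ∧ v + μ • P v ≠ 0 ∧
      P (v + μ • P v) = μ • (v + μ • P v) := by
  have h2 : (2 : k) ≠ 0 := NeZero.ne 2
  by_cases h : v + P v = 0
  · refine ⟨-1, by norm_num, add_mem hv (Submodule.smul_mem _ _ (hT v hv)), fun h' => h0 ?_, ?_⟩
    · have : (2 : k) • v = 0 := by linear_combination (norm := module) h + h'
      exact (smul_eq_zero.1 this).resolve_left h2
    · simp [hP, add_comm]
  · refine ⟨1, by norm_num, add_mem hv (Submodule.smul_mem _ _ (hT v hv)), by simpa using h, ?_⟩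
    simp [hP, add_comm]

theorem exists_joint_eigenvector {T : Submodule k E} {P Q : E →ₗ[k] E}
    (hPT : ∀ v ∈ T, P v ∈ T) (hP : ∀ v, P (P v) = v) (hQT : ∀ v ∈ T, Q v ∈ T)
    (hQ : ∀ v, Q (Q v) = v) (hPQ : ∀ v, P (Q v) = Q (P v)) {v : E} (hv : v ∈ T) (h0 : v ≠ 0) :
    ∃ w ∈ T, w ≠ 0 ∧ ∃ μ ν : k, μ * μ = 1 ∧ ν * ν = 1 ∧ P w = μ • w ∧ Q w = ν • w := by
  obtain ⟨μ, hμ, hw, hw0, hPw⟩ := exists_eigenvector_of_involution hPT hP hv h0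
  obtain ⟨ν, hν, hu, hu0, hQu⟩ := exists_eigenvector_of_involution hQT hQ hw hw0
  refine ⟨_, hu, hu0, μ, ν, hμ, hν, ?_, hQu⟩
  generalize v + μ • P v = w at *
  rw [map_add, map_smul, hPQ, hPw, map_smul]
  module

variable {T : Submodule k E} {X Y X' Y' : E →ₗ[k] E} {b : E →ₗ[k] E →ₗ[k] k}

/-- If `X` and `Y` commute, the associativity constraint forces `T = 0`. -/
theorem eq_zero_of_commuting_involutions
    (hXT : ∀ v ∈ T, X v ∈ T) (hYT : ∀ v ∈ T, Y v ∈ T)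
    (hX : ∀ v, X (X v) = v) (hY : ∀ v, Y (Y v) = v) (hX' : ∀ v, X' (X' v) = v)
    (hXY : ∀ v, X (Y v) = Y (X v)) (hXX' : ∀ v, X (X' v) = -X' (X v))
    (hb : ∀ v ∈ T, v ≠ 0 → ∃ w ∈ T, b v w ≠ 0)
    (hassoc : ∀ v ∈ T, ∀ w ∈ T, ∀ u ∈ T,
      b w u • v + b (X w) u • X' v = b v w • u + b (Y v) w • Y u) :
    ∀ v ∈ T, v = 0 := by
  have h2 : (2 : k) ≠ 0 := NeZero.ne 2
  intro v hv
  by_contra h0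
  obtain ⟨v, hv, h0, μ, ν, hμ, hν, hXv, hYv⟩ := exists_joint_eigenvector hXT hX hYT hY hXY hv h0
  have hX'v : X' v ≠ 0 := fun h => h0 (by rw [← hX' v, h, map_zero])
  -- With `u = v` the constraint has right side `2 b(v, w) v`, in the μ-eigenspace of `X`. On the
  -- left, `X' v` lies in the eigenspace of -μ because `X` and `X'` anticommute, so its coefficient
  -- must vanish.
  have key : ∀ w ∈ T, b (X w) v = 0 := by
    intro w hw
    have e1 := hassoc v hv w hw v hv
    have e2 := congrArg X e1
    simp only [map_add, map_smul, hYv, hXv, hXX', LinearMap.smul_apply] at e1 e2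
    have e3 : (2 * b (X w) v) • X' v = 0 := by
      have e4 : (b v w • v + (ν • b v w) • ν • v) = (2 * b v w) • v := by
        rw [smul_eq_mul, smul_smul, ← add_smul]; congr 1
        linear_combination b v w * hν
      have e5 : μ • (b v w • μ • v + (ν • b v w) • ν • μ • v) = (2 * b v w) • v := by
        simp only [smul_eq_mul, smul_smul, ← add_smul]; congr 1
        linear_combination b v w * hν * μ * μ + 2 * b v w * hμ
      have e6 : μ • (b w v • μ • v + b (X w) v • -(μ • X' v)) = b w v • v - b (X w) v • X' v := by
        have : (b w v • v - b (X w) v • X' v) = (μ * μ) • (b w v • v - b (X w) v • X' v) := by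
          rw [hμ, one_smul]
        rw [this]; module
      rw [e4] at e1
      have e7 : μ • _ = μ • _ := congrArg (fun t => μ • t) e2
      rw [e5, e6] at e7
      linear_combination (norm := module) e1 - e7
    have := (smul_eq_zero.1 e3).resolve_right hX'v
    exact (mul_eq_zero.1 this).resolve_left h2
  obtain ⟨w, hw, hvw⟩ := hb v hv h0
  have k1 := key w hw
  -- Since `X` is an involution, this also gives `b w v = 0`. The constraint then reduces to `2 b(v,
  -- w) v = 0`.
  have k2 := key (X w) (hXT w hw)
  rw [hX] at k2
  have e1 := hassoc v hv w hw v hv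
  rw [k1, k2, hYv] at e1
  simp only [map_smul, LinearMap.smul_apply, smul_eq_mul, zero_smul, add_zero, smul_smul,
    ← add_smul] at e1
  have := (smul_eq_zero.1 e1.symm).resolve_right h0
  apply hvw
  have : 2 * b v w = 0 := by linear_combination this - b v w * hν
  exact (mul_eq_zero.1 this).resolve_left h2

/-- If `X` and `Y` anticommute, the associativity constraint forces `X' = ± Y` and `Y' = ± X`. -/
theorem exists_sign_of_anticommuting_involutions
    (hXT : ∀ v ∈ T, X v ∈ T) (hYT : ∀ v ∈ T, Y v ∈ T) (hX'T : ∀ v ∈ T, X' v ∈ T)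
    (hY'T : ∀ v ∈ T, Y' v ∈ T)
    (hX : ∀ v, X (X v) = v) (hY : ∀ v, Y (Y v) = v) (hX' : ∀ v, X' (X' v) = v)
    (hXY : ∀ v, X (Y v) = -Y (X v)) (hXX' : ∀ v, X (X' v) = -X' (X v))
    (hYY' : ∀ v, Y (Y' v) = -Y' (Y v)) (hXY' : ∀ v, X (Y' v) = Y' (X v))
    (hYX' : ∀ v, Y (X' v) = X' (Y v))
    (hb : ∀ v ∈ T, v ≠ 0 → ∃ w ∈ T, b v w ≠ 0)
    (hbX : ∀ v ∈ T, ∀ w ∈ T, b (X' v) w = b v (X w))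
    (hbY : ∀ v ∈ T, ∀ w ∈ T, b (Y v) w = b v (Y' w))
    (hassoc : ∀ v ∈ T, ∀ w ∈ T, ∀ u ∈ T,
      b w u • v + b (X w) u • X' v = b v w • u + b (Y v) w • Y u) :
    ∃ α : k, α * α = 1 ∧ ∀ v ∈ T, X' v = α • Y v ∧ Y' v = α • X v := by
  have h2 : (2 : k) ≠ 0 := NeZero.ne 2
  by_cases hT : ∀ v ∈ T, v = 0
  · exact ⟨1, by norm_num, fun v hv => by simp [hT v hv]⟩
  push Not at hT
  obtain ⟨v, hv, h0⟩ := hT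
  obtain ⟨v, hv, h0, η, ν, hη, hν, hX'v, hYv⟩ :=
    exists_joint_eigenvector hX'T hX' hYT hY (fun v => (hYX' v).symm) hv h0
  obtain ⟨w₀, hw₀, hvw⟩ := hb v hv h0
  -- For `u` in the ν-eigenspace of `Y` the right side of the constraint is `2 b(v, w₀) u`, while
  -- the left side is a multiple of `v` because `v` is an eigenvector of `X'`. This eigenspace in
  -- `T` is therefore a line.
  have hline : ∀ u ∈ T, Y u = ν • u → ∃ r : k, u = r • v := by
    intro u hu hYu
    have e := hassoc v hv w₀ hw₀ u hu
    rw [hX'v, hYv, hYu] at e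
    simp only [map_smul, LinearMap.smul_apply, smul_eq_mul] at e
    refine ⟨(2 * b v w₀)⁻¹ * (b w₀ u + b (X w₀) u * η), ?_⟩
    have e' : (2 * b v w₀) • u = (b w₀ u + b (X w₀) u * η) • v := by
      have : (b v w₀ • u + (ν * b v w₀) • ν • u) = (2 * b v w₀) • u := by
        rw [smul_smul, ← add_smul]; congr 1
        linear_combination b v w₀ * hν
      rw [← this, ← e]; module
    rw [mul_smul, ← e', smul_smul, inv_mul_cancel₀ (mul_ne_zero h2 hvw), one_smul]
  -- As `X` anticommutes with `Y`, it exchanges the two eigenspaces of `Y`, so the other one is the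
  -- line through `X v`.
  have hspan : ∀ t ∈ T, ∃ r s : k, t = r • v + s • X v := by
    intro t ht
    obtain ⟨r, hr⟩ := hline (t + ν • Y t) (add_mem ht (Submodule.smul_mem _ _ (hYT t ht))) (by
      rw [map_add, map_smul, hY, smul_add, smul_smul, hν, one_smul, add_comm])
    obtain ⟨s, hs⟩ := hline (X (t - ν • Y t))
      (hXT _ (sub_mem ht (Submodule.smul_mem _ _ (hYT t ht)))) (by
        have : Y (X (t - ν • Y t)) = -X (Y (t - ν • Y t)) := by rw [hXY, neg_neg]
        rw [this, map_sub, map_smul, hY, ← map_neg, ← map_smul, smul_sub, smul_smul, hν, one_smul,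
          neg_sub])
    have hs' := congrArg X hs
    rw [hX, map_smul] at hs'
    refine ⟨2⁻¹ * r, 2⁻¹ * s, ?_⟩
    rw [mul_smul, mul_smul, ← hr, ← hs', ← smul_add]
    have : t + ν • Y t + (t - ν • Y t) = (2 : k) • t := by module
    rw [this, smul_smul, inv_mul_cancel₀ h2, one_smul]
  -- Both `X` and `Y'` anticommute with `Y`, so `X (Y' v)` is again in the ν-eigenspace.
  obtain ⟨γ, hγ⟩ := hline (X (Y' v)) (hXT _ (hY'T v hv)) (by
    have : Y (X (Y' v)) = -X (Y (Y' v)) := by rw [hXY, neg_neg]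
    rw [this, hYY', hYv, map_neg, neg_neg, map_smul, map_smul])
  have hY'v : Y' v = γ • X v := by rw [← hX (Y' v), hγ, map_smul]
  have hX't : ∀ t ∈ T, X' t = (η * ν) • Y t := by
    intro t ht
    obtain ⟨r, s, rfl⟩ := hspan t ht
    have e1 : X' (X v) = -η • X v := by
      have := hXX' v
      rw [hX'v, map_smul] at this
      rw [neg_smul, this, neg_neg]
    have e2 : Y (X v) = -ν • X v := by
      have := hXY v
      rw [hYv, map_smul] at this
      rw [neg_smul, this, neg_neg]
    simp only [map_add, map_smul, e1, e2, hX'v, hYv]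
    match_scalars
    · linear_combination (-η) * r * hν
    · linear_combination η * s * hν
  have hY't : ∀ t ∈ T, Y' t = γ • X t := by
    intro t ht
    obtain ⟨r, s, rfl⟩ := hspan t ht
    have e1 : Y' (X v) = γ • v := by rw [← hXY', hγ]
    simp only [map_add, map_smul, e1, hY'v, hX]
    module
  -- Evaluating `b (X' v) (X w₀)` through the adjoint of `X'` gives `b v w₀`; through `X' = η ν Y`
  -- and the adjoint of `Y` it gives `η ν γ b v w₀`.
  have hone : η * ν * γ = 1 := by
    have e1 := hbX v hv (X w₀) (hXT _ hw₀)
    have e2 := hbY v hv (X w₀) (hXT _ hw₀)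
    rw [hX't v hv, map_smul, LinearMap.smul_apply, e2, hY't _ (hXT _ hw₀), hX] at e1
    simp only [map_smul, smul_eq_mul] at e1
    have : (η * ν * γ - 1) * b v w₀ = 0 := by linear_combination e1
    exact sub_eq_zero.1 ((mul_eq_zero.1 this).resolve_right hvw)
  have hsq : (η * ν) * (η * ν) = 1 := by linear_combination ν * ν * hη + hν
  have hγ' : γ = η * ν := by linear_combination (η * ν) * hone - γ * hsq
  exact ⟨η * ν, hsq, fun t ht => ⟨hX't t ht, by rw [hY't t ht, hγ']⟩⟩

end linearAlgebra

/-! ### Existence of characters. -/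

section characters
variable {k : Type*} [Field k] [IsAlgClosed k] {A : Type*} [Ring A] [Algebra k A]
  [FiniteDimensional k A]

/-- The residue field at a maximal ideal is finite over the algebraically closed `k`, hence equal to
it. -/
theorem exists_character_of_comm {B : Type*} [CommRing B] [Algebra k B] [Nontrivial B]
    [FiniteDimensional k B] : Nonempty (B →ₐ[k] k) := by
  obtain ⟨m, hm⟩ := Ideal.exists_maximal B
  have := Ideal.Quotient.isDomain m
  have bij := IsAlgClosed.algebraMap_bijective_of_isIntegral (k := k) (K := B ⧸ m)
  let e : k ≃ₐ[k] B ⧸ m := AlgEquiv.ofBijective (Algebra.ofId k _) bij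
  exact ⟨e.symm.toAlgHom.comp (Ideal.Quotient.mkₐ k m)⟩

theorem exists_character_of_algHom {B : Type*} [Ring B] [Algebra k B] [Nontrivial B]
    (φ : A →ₐ[k] B) (h : ∀ a b, φ a * φ b = φ b * φ a) : Nonempty (A →ₐ[k] k) := by
  let _ : CommRing φ.range := { Subalgebra.toRing φ.range with
    mul_comm := by
      rintro ⟨_, a, rfl⟩ ⟨_, b, rfl⟩
      exact Subtype.ext (h a b) }
  have : FiniteDimensional k φ.range :=
    Module.Finite.of_surjective φ.rangeRestrict.toLinearMap φ.rangeRestrict_surjective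
  obtain ⟨χ⟩ := exists_character_of_comm (k := k) (B := φ.range)
  exact ⟨χ.comp φ.rangeRestrict⟩

/-- If `A` acts on a nonzero ideal `A f` through commuting operators, then it has a character. -/
theorem exists_character_of_central {f : A} (hf : f ≠ 0) (hc : ∀ a, a * f = f * a)
    (h : ∀ a b, a * b * f = b * a * f) : Nonempty (A →ₐ[k] k) := by
  let W : Submodule k A := LinearMap.range (LinearMap.mulRight k f)
  let φ : A →ₐ[k] Module.End k W := AlgHom.ofLinearMap
    { toFun := fun a => (LinearMap.mulLeft k a).restrict (p := W) (q := W) (by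
        rintro _ ⟨b, rfl⟩; exact ⟨a * b, by simp [mul_assoc]⟩)
      map_add' := fun a b => by ext; simp [add_mul]
      map_smul' := fun r a => by ext; simp }
    (by ext; simp) (fun a b => by ext; simp)
  have hW : Nontrivial W := ⟨⟨⟨f, 1, by simp⟩, 0, fun e => hf (congrArg Subtype.val e)⟩⟩
  refine exists_character_of_algHom (B := Module.End k W) φ (fun a b => ?_)
  rw [← map_mul, ← map_mul]
  ext ⟨_, ⟨c, rfl⟩⟩
  change a * b * (c * f) = b * a * (c * f)
  -- Centrality moves `f` next to `a * b`, where the hypothesis applies.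
  rw [hc c, ← mul_assoc, h a b, mul_assoc]

end characters

/-! ### From a character to an embedding into the Hopf algebra. -/

namespace LeftCoaction
section characterEmbedding
variable {k : Type*} [Field k] {H : Type*} [Ring H] [Bialgebra k H]
  {A : Type*} [Ring A] [Algebra k A] (ρ : LeftCoaction k H A)

/-- The morphism of comodule algebras `A → H` given by a character of `A`. -/
noncomputable def ofCharacter (χ : A →ₐ[k] k) : A →ₐ[k] H :=
  (Algebra.TensorProduct.rid k k H).toAlgHom.comp
    ((Algebra.TensorProduct.map (AlgHom.id k H) χ).comp ρ.toAlgHom)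

/-- The map `(id ⊗ χ) λ` is colinear: this is coassociativity of `λ` with χ applied to the last
factor. -/
theorem comul_ofCharacter (χ : A →ₐ[k] k) (a : A) :
    Coalgebra.comul (R := k) (ρ.ofCharacter χ a) =
      Algebra.TensorProduct.map (AlgHom.id k H) (ρ.ofCharacter χ) (ρ.toAlgHom a) := by
  have e1 : ∀ t : H ⊗[k] A,
      Coalgebra.comul (R := k) (Algebra.TensorProduct.rid k k H
        (Algebra.TensorProduct.map (AlgHom.id k H) χ t)) =
      Algebra.TensorProduct.map (AlgHom.id k H) ((Algebra.TensorProduct.rid k k H).toAlgHom.comp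
        (Algebra.TensorProduct.map (AlgHom.id k H) χ))
        (Algebra.TensorProduct.assoc k k k H H A
          (Algebra.TensorProduct.map (Bialgebra.comulAlgHom k H) (AlgHom.id k A) t)) := by
    have e : ∀ (u : H ⊗[k] H) (a : A),
        Algebra.TensorProduct.map (AlgHom.id k H) ((Algebra.TensorProduct.rid k k H).toAlgHom.comp
          (Algebra.TensorProduct.map (AlgHom.id k H) χ))
          (Algebra.TensorProduct.assoc k k k H H A (u ⊗ₜ a)) = χ a • u := by
      intro u a
      induction u using TensorProduct.induction_on with
      | zero => simp
      | tmul g h => simp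
      | add u v hu hv => rw [TensorProduct.add_tmul, map_add, map_add, hu, hv, smul_add]
    intro t
    induction t using TensorProduct.induction_on with
    | zero => simp
    | tmul h a =>
      rw [Algebra.TensorProduct.map_tmul, Algebra.TensorProduct.map_tmul, AlgHom.id_apply,
        AlgHom.id_apply, e]
      simp
    | add u v hu hv => simp only [map_add, hu, hv]
  change Coalgebra.comul (R := k) (Algebra.TensorProduct.rid k k H
        (Algebra.TensorProduct.map (AlgHom.id k H) χ (ρ.toAlgHom a))) = _
  rw [e1, ρ.coassoc]
  generalize ρ.toAlgHom a = t
  induction t using TensorProduct.induction_on with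
  | zero => simp
  | tmul h a => simp [ofCharacter]
  | add u v hu hv => simp only [map_add, hu, hv]

/-- The kernel is a right ideal, and it is costable because the map is colinear and `H ⊗ -`
preserves kernels. It is not all of `A`, since the image of 1 has counit 1. -/
theorem IsRightSimple.ofCharacter_injective {ρ : LeftCoaction k H A} (hρ : ρ.IsRightSimple)
    (χ : A →ₐ[k] k) : Function.Injective (ρ.ofCharacter χ) := by
  have hker : LinearMap.ker (ρ.ofCharacter χ).toLinearMap = ⊥ := by
    refine (hρ.eq_bot_or_eq_top _ ?_ ?_).resolve_right ?_
    · intro a ha b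
      have ha : ρ.ofCharacter χ a = 0 := ha
      change ρ.ofCharacter χ (a * b) = 0
      rw [map_mul, ha, zero_mul]
    · intro a ha
      have ha : ρ.ofCharacter χ a = 0 := ha
      have h := ρ.comul_ofCharacter χ a
      rw [ha, map_zero] at h
      exact (Module.Flat.lTensor_exact H
        (LinearMap.exact_subtype_ker_map (ρ.ofCharacter χ).toLinearMap) _).1 h.symm
    · intro h
      have h1 : (1 : A) ∈ LinearMap.ker (ρ.ofCharacter χ).toLinearMap := h ▸ Submodule.mem_top
      have h1 : ρ.ofCharacter χ 1 = 0 := h1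
      rw [map_one] at h1
      have h2 := congrArg (Coalgebra.counit (R := k)) h1
      rw [Bialgebra.counit_one, map_zero] at h2
      exact one_ne_zero h2
  exact LinearMap.ker_eq_bot.1 hker

/-- A right simple comodule algebra with a character is a coideal subalgebra. -/
theorem IsRightSimple.exists_coidealSubalgebra {ρ : LeftCoaction k H A} (hρ : ρ.IsRightSimple)
    (χ : A →ₐ[k] k) : ∃ B : CoidealSubalgebra k H, Nonempty (ρ.Iso B.coaction) := by
  let Φ := ρ.ofCharacter χ
  let B : CoidealSubalgebra k H :=
    { Φ.range with
      comul_mem := by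
        rintro _ ⟨a, rfl⟩
        change Coalgebra.comul (R := k) (ρ.ofCharacter χ a) ∈ _
        rw [comul_ofCharacter]
        generalize ρ.toAlgHom a = t
        induction t using TensorProduct.induction_on with
        | zero => simp
        | tmul h a =>
          exact ⟨h ⊗ₜ ⟨ρ.ofCharacter χ a, a, rfl⟩, by simp⟩
        | add u v hu hv => rw [map_add]; exact add_mem hu hv }
  let e : A ≃ₐ[k] B.toSubalgebra := AlgEquiv.ofInjective Φ (hρ.ofCharacter_injective χ)
  refine ⟨B, ⟨⟨e, fun a => B.tensorVal_injective ?_⟩⟩⟩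
  change B.tensorVal (B.coactionHom (e a)) = _
  rw [B.tensorVal_coactionHom]
  change Coalgebra.comul (R := k) (ρ.ofCharacter χ a) = _
  rw [comul_ofCharacter]
  generalize ρ.toAlgHom a = t
  induction t using TensorProduct.induction_on with
  | zero => simp
  | tmul h a => simp [CoidealSubalgebra.tensorVal]; rfl
  | add u v hu hv => simp only [map_add, hu, hv]

end characterEmbedding
end LeftCoaction

/-! ### Characters from central elements, and supports other than `K`. -/

namespace KP
open LeftCoaction
section cases
variable {k : Type*} [Field k] [NeZero (2 : k)] {A : Type*} [Ring A] [Algebra k A]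
  {ρ : LeftCoaction k (KP k) A}

/-- On `A f` the semi-invariants act by scalars, and so do products of two odd elements, that is, of
sums of entries of pairs, because such products have only weight components. It remains to see that
odd elements m and n commute on f, which holds since `m n m f` can be evaluated in two ways. -/
theorem exists_character_of_weights [IsAlgClosed k] (hρ : ρ.IsAMExact) {f : A} (hf : f ≠ 0)
    (hc : ∀ a, a * f = f * a)
    (hx : ∀ a, ρ.IsWeight (x k) a → ∃ r : k, a * f = r • f)
    (hy : ∀ a, ρ.IsWeight (y k) a → ∃ r : k, a * f = r • f)
    (hxy : ∀ a, ρ.IsWeight (x k * y k) a → ∃ r : k, a * f = r • f) :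
    Nonempty (A →ₐ[k] k) := by
  have := hρ.finiteDimensional
  let S : Submodule k A := (k ∙ f).comap (LinearMap.mulRight k f)
  have hS : ∀ a, a ∈ S ↔ ∃ r : k, a * f = r • f := fun a => by
    simp only [S, Submodule.mem_comap, Submodule.mem_span_singleton, LinearMap.mulRight_apply,
      eq_comm]
  have h1 : ∀ a, ρ.IsWeight 1 a → a ∈ S := fun a ha => by
    obtain ⟨r, rfl⟩ := hρ.exists_eq_smul_one ha
    exact (hS _).2 ⟨r, by simp⟩
  have hmul : ∀ v ∈ pairs ρ, ∀ w ∈ pairs ρ,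
      v.1 * w.1 ∈ S ∧ v.1 * w.2 ∈ S ∧ v.2 * w.1 ∈ S ∧ v.2 * w.2 ∈ S := by
    intro v hv w hw
    obtain ⟨b1, bx, by', bxy⟩ := isWeight_beta hv hw
    have b1 := h1 _ b1
    have bx := (hS _).2 (hx _ bx)
    have by' := (hS _).2 (hy _ by')
    have bxy := (hS _).2 (hxy _ bxy)
    rw [fst_mul_fst (k := k) v w, fst_mul_snd (k := k) v w, snd_mul_fst (k := k) v w,
      snd_mul_snd (k := k) v w]
    exact ⟨add_mem (add_mem (add_mem b1 bx) by') bxy, sub_mem (add_mem (sub_mem b1 bx) by') bxy,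
      sub_mem (sub_mem (add_mem b1 bx) by') bxy, sub_mem (add_mem (add_mem (neg_mem b1) bx) by') bxy⟩
  have hodd : ∀ v ∈ pairs ρ, ∀ v' ∈ pairs ρ, ∀ w ∈ pairs ρ, ∀ w' ∈ pairs ρ,
      (v.1 + v'.2) * (w.1 + w'.2) ∈ S := by
    intro v hv v' hv' w hw w' hw'
    rw [add_mul, mul_add, mul_add]
    exact add_mem (add_mem (hmul v hv w hw).1 (hmul v hv w' hw').2.1)
      (add_mem (hmul v' hv' w hw).2.2.1 (hmul v' hv' w' hw').2.2.2)
  -- If `m n f = r f` and `n m f = s f`, then `m n m f` equals both `r m f` and `s m f`. So `r = s`,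
  -- unless `m f = 0`, in which case `m n f = m f n` would vanish.
  have aux : ∀ m n : A, m * n ∈ S → n * m ∈ S → m * n * f ≠ 0 → m * n * f = n * m * f := by
    intro m n hm hn h0
    obtain ⟨r, hr⟩ := (hS _).1 hm
    obtain ⟨s, hs⟩ := (hS _).1 hn
    have e1 : m * n * m * f = r • (m * f) := by
      rw [mul_assoc, hc m, ← mul_assoc, hr, smul_mul_assoc, ← hc m]
    have e2 : m * n * m * f = s • (m * f) := by
      rw [mul_assoc m, mul_assoc m, hs, mul_smul_comm]
    have e3 : (r - s) • (m * f) = 0 := by rw [sub_smul, ← e1, ← e2, sub_self]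
    rcases smul_eq_zero.1 e3 with h | h
    · rw [hr, hs, sub_eq_zero.1 h]
    · exfalso
      apply h0
      rw [mul_assoc, hc n, ← mul_assoc, h, zero_mul]
  have hcomm : ∀ m n : A, m * n ∈ S → n * m ∈ S → m * n * f = n * m * f := by
    intro m n hm hn
    by_cases h : m * n * f = 0
    · by_contra h'
      rw [h] at h'
      exact h' (h ▸ (aux n m hn hm (Ne.symm h')).symm)
    · exact aux m n hm hn h
  refine exists_character_of_central hf hc (fun a b => ?_)
  obtain ⟨p1, px, py, pxy, v, v', i1, ix, iy, ixy, hv, hv', rfl⟩ := exists_components ρ a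
  obtain ⟨q1, qx, qy, qxy, w, w', j1, jx, jy, jxy, hw, hw', rfl⟩ := exists_components ρ b
  have hp := add_mem (add_mem (add_mem (h1 _ i1) ((hS _).2 (hx _ ix))) ((hS _).2 (hy _ iy)))
    ((hS _).2 (hxy _ ixy))
  have hq := add_mem (add_mem (add_mem (h1 _ j1) ((hS _).2 (hx _ jx))) ((hS _).2 (hy _ jy)))
    ((hS _).2 (hxy _ jxy))
  have hmn := hcomm _ _ (hodd v hv v' hv' w hw w' hw') (hodd w hw w' hw' v hv v' hv')
  generalize p1 + px + py + pxy = p at *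
  generalize q1 + qx + qy + qxy = q at *
  generalize v.1 + v'.2 = m at *
  generalize w.1 + w'.2 = n at *
  obtain ⟨r, hr⟩ := (hS _).1 hp
  obtain ⟨s, hs⟩ := (hS _).1 hq
  have e1 : p * n * f = r • (n * f) := by
    rw [mul_assoc, hc n, ← mul_assoc, hr, smul_mul_assoc]
  have e2 : q * m * f = s • (m * f) := by
    rw [mul_assoc, hc m, ← mul_assoc, hs, smul_mul_assoc]
  have e3 : p * q * f = s • r • f := by rw [mul_assoc, hs, mul_smul_comm, hr]
  have e4 : q * p * f = s • r • f := by rw [mul_assoc, hr, mul_smul_comm, hs, smul_comm]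
  have e5 : m * q * f = s • (m * f) := by rw [mul_assoc, hs, mul_smul_comm]
  have e6 : n * p * f = r • (n * f) := by rw [mul_assoc, hr, mul_smul_comm]
  simp only [add_mul, mul_add, e1, e2, e3, e4, e5, e6, hmn, hc m, hc n]
  abel

theorem central_of_components {f : A} (hρ : ρ.IsAMExact)
    (hx : ∀ a, ρ.IsWeight (x k) a → a * f = f * a)
    (hy : ∀ a, ρ.IsWeight (y k) a → a * f = f * a)
    (hxy : ∀ a, ρ.IsWeight (x k * y k) a → a * f = f * a)
    (hv : ∀ v ∈ pairs ρ, v.1 * f = f * v.1 ∧ v.2 * f = f * v.2) (a : A) : a * f = f * a := by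
  obtain ⟨p1, px, py, pxy, v, w, h1, ix, iy, ixy, iv, iw, rfl⟩ := exists_components ρ a
  obtain ⟨r, rfl⟩ := hρ.exists_eq_smul_one h1
  simp only [add_mul, mul_add, hx _ ix, hy _ iy, hxy _ ixy, (hv _ iv).1, (hv _ iw).2,
    smul_mul_assoc, mul_smul_comm, one_mul, mul_one]

/-- The functional only serves to read off the scalar in a multiple of 1, which makes the form
linear on all of `A × A`. -/
theorem exists_normalizing_functional (hρ : ρ.IsAMExact) : ∃ τ : A →ₗ[k] k, τ 1 = 1 := by
  have := hρ.isRightSimple.nontrivial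
  have h : ¬ ∀ φ : Module.Dual k A, φ 1 = 0 := fun h =>
    one_ne_zero ((Module.forall_dual_apply_eq_zero_iff k (1 : A)).1 h)
  push Not at h
  obtain ⟨φ, hφ⟩ := h
  exact ⟨(φ 1)⁻¹ • φ, by simp [hφ]⟩

theorem form_nondegenerate (hρ : ρ.IsAMExact) {τ : A →ₗ[k] k} (hτ : τ 1 = 1) {v : A × A}
    (hv : v ∈ pairs ρ) (h0 : v ≠ 0) : ∃ w ∈ pairs ρ, form k τ v w ≠ 0 := by
  obtain ⟨w, hw, h⟩ := exists_beta1_ne_zero hρ hv h0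
  refine ⟨w, hw, fun h' => h ?_⟩
  rw [beta1_eq hρ hτ hv hw, h', zero_smul]

/-- In `v.1 (w.1 v.2) = (v.1 w.1) v.2` the products of two entries have only components of weights 1
and x. Every resulting term is a first entry of a pair except `form(v, w) v.2`, so this one
vanishes, against nondegeneracy. -/
theorem pairs_eq_zero_of_y (hρ : ρ.IsAMExact) (hy : ∀ a, ρ.IsWeight (y k) a → a = 0)
    (hxy : ∀ a, ρ.IsWeight (x k * y k) a → a = 0) : ∀ v ∈ pairs ρ, v = 0 := by
  intro v hv
  by_contra h0
  obtain ⟨τ, hτ⟩ := exists_normalizing_functional hρ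
  obtain ⟨w, hw, hvw⟩ := form_nondegenerate hρ hτ hv h0
  obtain ⟨-, cx, cy, cxy⟩ := isWeight_beta hv hw
  obtain ⟨-, dx, dy, dxy⟩ := isWeight_beta hw hv
  have e : v.1 * (w.1 * v.2) = v.1 * w.1 * v.2 := (mul_assoc _ _ _).symm
  rw [fst_mul_fst (k := k) v w, fst_mul_snd (k := k) w v, hy _ cy, hy _ dy, hxy _ cxy, hxy _ dxy,
    beta1_eq hρ hτ hv hw, beta1_eq hρ hτ hw hv] at e
  have m1 := sub_mem (sub_mem (Submodule.smul_mem _ (form k τ w v) hv) (rightX_mem dx hv))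
    (leftX_mem cx hv)
  have m2 := Submodule.smul_mem _ (-form k τ v w) hv
  have := (pairs_eq_zero m1 m2 (by
    simp only [rightX_apply, leftX_apply, Prod.fst_sub, Prod.smul_fst, Prod.smul_snd]
    simp only [add_zero, sub_zero, mul_sub, add_mul, mul_smul_comm, smul_mul_assoc, mul_one,
      one_mul] at e
    rw [e]; module)).2
  rcases smul_eq_zero.1 this with h | h
  · exact hvw (neg_eq_zero.1 h)
  · exact h0 h

/-- The roles of the slots are reversed: in `w.1 (w.1 u.2) = (w.1 w.1) u.2` an element of weight y
acting on the right exchanges entries, so `form(w, u) w.1` is the only first entry. -/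
theorem pairs_eq_zero_of_x (hρ : ρ.IsAMExact) (hx : ∀ a, ρ.IsWeight (x k) a → a = 0)
    (hxy : ∀ a, ρ.IsWeight (x k * y k) a → a = 0) : ∀ v ∈ pairs ρ, v = 0 := by
  intro w hw
  by_contra h0
  obtain ⟨τ, hτ⟩ := exists_normalizing_functional hρ
  obtain ⟨u, hu, hwu⟩ := form_nondegenerate hρ hτ hw h0
  obtain ⟨-, cx, cy, cxy⟩ := isWeight_beta hw hw
  obtain ⟨-, dx, dy, dxy⟩ := isWeight_beta hw hu
  have e : w.1 * (w.1 * u.2) = w.1 * w.1 * u.2 := (mul_assoc _ _ _).symm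
  rw [fst_mul_fst (k := k) w w, fst_mul_snd (k := k) w u, hx _ cx, hx _ dx, hxy _ cxy, hxy _ dxy,
    beta1_eq hρ hτ hw hw, beta1_eq hρ hτ hw hu] at e
  have m1 := Submodule.smul_mem _ (form k τ w u) hw
  have m2 := add_mem (sub_mem (rightY_mem dy hw) (Submodule.smul_mem _ (form k τ w w) hu))
    (leftY_mem cy hu)
  have := (pairs_eq_zero m1 m2 (by
    simp only [rightY_apply, leftY_apply, Prod.snd_sub, Prod.snd_add, Prod.smul_fst, Prod.smul_snd]
    simp only [add_zero, sub_zero, mul_add, add_mul, mul_smul_comm, smul_mul_assoc, mul_one,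
      one_mul] at e
    rw [← add_sub_cancel_left (form k τ w u • w.1) (w.1 * betay k w u), e]; module)).1
  rcases smul_eq_zero.1 this with h | h
  · exact hwu h
  · exact h0 h

theorem one_add_ne_zero [Nontrivial A] {u : A} (hu : u ∈ noninvariant ρ) : 1 + u ≠ 0 := by
  intro h
  apply one_notMem_noninvariant (ρ := ρ)
  rw [eq_neg_of_add_eq_zero_left h]
  exact neg_mem hu

/-- Associativity of first entries shows that the form lives on a line, where `leftXY k u` and
`rightXY k u` are adjoint scalars, hence equal. So `u` is central, and `f = 1 + u` satisfies `u * f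
= f`. -/
theorem exists_character_of_xy [IsAlgClosed k] (hρ : ρ.IsAMExact)
    (hx : ∀ a, ρ.IsWeight (x k) a → a = 0) (hy : ∀ a, ρ.IsWeight (y k) a → a = 0)
    {u : A} (hu : ρ.IsWeight (x k * y k) u) (huu : u * u = 1)
    (hxy : ∀ a, ρ.IsWeight (x k * y k) a → ∃ r : k, a = r • u) : Nonempty (A →ₐ[k] k) := by
  have := hρ.isRightSimple.nontrivial
  obtain ⟨τ, hτ⟩ := exists_normalizing_functional hρ
  have hadj : ∀ v ∈ pairs ρ, leftXY k u v = rightXY k u v := by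
    refine eq_of_form_adjoint (b := form k τ) (fun v hv => leftXY_mem hu hv)
      (fun v hv => rightXY_mem hu hv) (fun v hv h0 => form_nondegenerate hρ hτ hv h0) ?_ ?_
    · intro v hv w hw
      rw [form_apply, form_apply, beta1_leftXY, beta1_rightXY]
      obtain ⟨r, hr⟩ := hxy _ (isWeight_beta hv hw).2.2.2
      rw [hr, mul_smul_comm, smul_mul_assoc]
    · intro v hv w hw t ht
      obtain ⟨-, cx, cy, cxy⟩ := isWeight_beta hv hw
      obtain ⟨-, dx, dy, dxy⟩ := isWeight_beta hw ht
      have e : v.1 * (w.1 * t.1) = v.1 * w.1 * t.1 := (mul_assoc _ _ _).symm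
      rw [fst_mul_fst (k := k) v w, fst_mul_fst (k := k) w t, hx _ cx, hx _ dx, hy _ cy, hy _ dy,
        beta1_eq hρ hτ hv hw, beta1_eq hρ hτ hw ht] at e
      refine (pairs_inj (Submodule.smul_mem _ _ hv) (rightXY_mem dxy hv)
        (Submodule.smul_mem _ _ ht) (leftXY_mem cxy ht) ?_).1
      simp only [add_zero, mul_add, add_mul, mul_smul_comm, smul_mul_assoc, mul_one, one_mul] at e
      exact e
  have hv : ∀ v ∈ pairs ρ, v.1 * u = u * v.1 ∧ v.2 * u = u * v.2 := by
    intro v hv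
    have h := hadj v hv
    rw [leftXY_apply, rightXY_apply, Prod.mk.injEq, neg_inj] at h
    exact ⟨h.2.symm, h.1.symm⟩
  refine exists_character_of_weights hρ (one_add_ne_zero (mem_noninvariant_xy hu))
    (central_of_components hρ (fun a ha => by simp [hx a ha]) (fun a ha => by simp [hy a ha])
      (fun a ha => ?_) (fun v h => ?_))
    (fun a ha => ⟨0, by simp [hx a ha]⟩) (fun a ha => ⟨0, by simp [hy a ha]⟩) (fun a ha => ?_)
  · obtain ⟨r, rfl⟩ := hxy a ha
    simp [mul_add, add_mul]
  · simp only [mul_add, add_mul, (hv v h).1, (hv v h).2, mul_one, one_mul, and_self]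
  · obtain ⟨r, rfl⟩ := hxy a ha
    exact ⟨r, by rw [mul_add, mul_one, smul_mul_assoc, huu, ← smul_add, add_comm]⟩

/-- The case of a commutative coinvariant part spanned by `1` and one semi-invariant. -/
theorem exists_character_of_pairs_eq_zero [IsAlgClosed k] (hρ : ρ.IsAMExact)
    (hp : ∀ v ∈ pairs ρ, v = 0) {u : A} (hu : u ∈ noninvariant ρ)
    (hx : ∀ a, ρ.IsWeight (x k) a → ∃ r : k, a * (1 + u) = r • (1 + u) ∧ a * u = u * a)
    (hy : ∀ a, ρ.IsWeight (y k) a → ∃ r : k, a * (1 + u) = r • (1 + u) ∧ a * u = u * a)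
    (hxy : ∀ a, ρ.IsWeight (x k * y k) a → a = 0) : Nonempty (A →ₐ[k] k) := by
  have := hρ.isRightSimple.nontrivial
  refine exists_character_of_weights hρ (one_add_ne_zero hu)
    (central_of_components hρ (fun a ha => ?_) (fun a ha => ?_)
      (fun a ha => by simp [hxy a ha]) (fun v h => by simp [hp v h]))
    (fun a ha => (hx a ha).imp fun _ h => h.1) (fun a ha => (hy a ha).imp fun _ h => h.1)
    (fun a ha => ⟨0, by simp [hxy a ha]⟩)
  · obtain ⟨r, -, h⟩ := hx a ha
    simp [mul_add, add_mul, h]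
  · obtain ⟨r, -, h⟩ := hy a ha
    simp [mul_add, add_mul, h]

end cases
end KP

/-! ### Operator relations and maps out of the twisted group algebra. -/

namespace KP
open LeftCoaction
section operatorRelations
variable {k : Type*} [Field k] {A : Type*} [Ring A] [Algebra k A]

theorem leftX_leftX {u : A} (hu : u * u = 1) (v : A × A) : leftX k u (leftX k u v) = v := by
  simp [leftX_apply, ← mul_assoc, hu]
theorem leftY_leftY {u : A} (hu : u * u = 1) (v : A × A) : leftY k u (leftY k u v) = v := by
  simp [leftY_apply, ← mul_assoc, hu]
theorem rightX_rightX {u : A} (hu : u * u = 1) (v : A × A) : rightX k u (rightX k u v) = v := by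
  simp [rightX_apply, mul_assoc, hu]
theorem leftX_rightX (u u' : A) (v : A × A) :
    leftX k u (rightX k u' v) = -rightX k u' (leftX k u v) := by
  ext <;> simp [leftX_apply, rightX_apply, mul_assoc]
theorem leftY_rightY (u u' : A) (v : A × A) :
    leftY k u (rightY k u' v) = -rightY k u' (leftY k u v) := by
  ext <;> simp [leftY_apply, rightY_apply, mul_assoc]
theorem leftX_rightY (u u' : A) (v : A × A) :
    leftX k u (rightY k u' v) = rightY k u' (leftX k u v) := by
  ext <;> simp [leftX_apply, rightY_apply, mul_assoc]
theorem leftY_rightX (u u' : A) (v : A × A) :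
    leftY k u (rightX k u' v) = rightX k u' (leftY k u v) := by
  ext <;> simp [leftY_apply, rightX_apply, mul_assoc]
-- The swap in `leftX` and the sign in `leftY` anticommute, so commuting elements give anticommuting
-- operators and conversely.
theorem leftX_leftY_of_comm {a b : A} (h : a * b = b * a) (v : A × A) :
    leftX k a (leftY k b v) = -leftY k b (leftX k a v) := by
  ext <;> simp [leftX_apply, leftY_apply, ← mul_assoc, h]
theorem leftX_leftY_of_anticomm {a b : A} (h : a * b = -(b * a)) (v : A × A) :
    leftX k a (leftY k b v) = leftY k b (leftX k a v) := by
  ext <;> simp [leftX_apply, leftY_apply, ← mul_assoc, h]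

end operatorRelations

section twistedHom
variable {k : Type*} [Field k] {A : Type*} [Ring A] [Algebra k A] {a b : A}

/-- The basis element of weight `g` in a comodule algebra with anticommuting units of weights
`x` and `y`. -/
def monomial (a b : A) (g : Klein) : A := a ^ (g.1.toAdd.val) * b ^ (g.2.toAdd.val)

theorem monomial_mul_monomial (haa : a * a = 1) (hbb : b * b = 1) (hab : a * b = -(b * a))
    (g h : Klein) : monomial a b g * monomial a b h =
      (((Klein.cocycle k).toFun g h : kˣ) : k) • monomial a b (g * h) := by
  have hba : b * a = -(a * b) := by rw [hab, neg_neg]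
  have hv : ∀ n : Multiplicative (ZMod 2), n = 1 ∨ n = Multiplicative.ofAdd 1 := by decide
  have h11 : (Multiplicative.ofAdd (1 : ZMod 2)) * Multiplicative.ofAdd 1 = 1 := by decide
  have haab : ∀ c, a * (a * c) = c := fun c => by rw [← mul_assoc, haa, one_mul]
  have hbac : ∀ c, b * (a * c) = -(a * (b * c)) := fun c => by
    rw [← mul_assoc, hba, neg_mul, mul_assoc]
  obtain ⟨g1, g2⟩ := g
  obtain ⟨h1, h2⟩ := h
  rcases hv g1 with rfl | rfl <;> rcases hv g2 with rfl | rfl <;> rcases hv h1 with rfl | rfl <;>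
    rcases hv h2 with rfl | rfl <;>
    simp [monomial, Klein.cocycle, ZMod.val_one, haa, hbb, hba, haab, hbac, mul_assoc, h11]

variable (k) in
/-- The map `k^ψ[K] → A` with `e g ↦ monomial a b g`. -/
noncomputable def twistedHom (haa : a * a = 1) (hbb : b * b = 1) (hab : a * b = -(b * a)) :
    TwistedGroupAlgebra (Klein.cocycle k) →ₐ[k] A :=
  have he : ∀ g, Finsupp.linearCombination k (monomial a b)
      (TwistedGroupAlgebra.e (Klein.cocycle k) g).coeff = monomial a b g := fun g => by
    simp [TwistedGroupAlgebra.e]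
  AlgHom.ofLinearMap
    { toFun := fun p => Finsupp.linearCombination k (monomial a b) p.coeff
      map_add' := fun p q => by rw [TwistedGroupAlgebra.add_coeff, map_add]
      map_smul' := fun r p => by rw [TwistedGroupAlgebra.smul_coeff, map_smul, RingHom.id_apply] }
    ((he 1).trans (by simp [monomial]))
    (fun p q => by
      change Finsupp.linearCombination k (monomial a b) (p * q).coeff =
        Finsupp.linearCombination k (monomial a b) p.coeff *
        Finsupp.linearCombination k (monomial a b) q.coeff
      induction p using TwistedGroupAlgebra.induction_on with
      | h0 => simp [TwistedGroupAlgebra.zero_coeff]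
      | hadd p p' h h' => simp only [add_mul, TwistedGroupAlgebra.add_coeff, map_add, h, h']
      | he r g =>
        induction q using TwistedGroupAlgebra.induction_on with
        | h0 => simp [TwistedGroupAlgebra.zero_coeff]
        | hadd p p' h h' => simp only [mul_add, TwistedGroupAlgebra.add_coeff, map_add, h, h']
        | he s h => simp only [smul_mul_assoc, mul_smul_comm, TwistedGroupAlgebra.e_mul_e,
            TwistedGroupAlgebra.smul_coeff, map_smul, he, monomial_mul_monomial (k := k) haa hbb hab])

theorem twistedHom_e (haa : a * a = 1) (hbb : b * b = 1) (hab : a * b = -(b * a)) (g : Klein) :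
    twistedHom k haa hbb hab (TwistedGroupAlgebra.e _ g) = monomial a b g := by
  change Finsupp.linearCombination k (monomial a b)
    (TwistedGroupAlgebra.e (Klein.cocycle k) g).coeff = _
  simp [TwistedGroupAlgebra.e]

end twistedHom

/-! ### Comodule algebras in which all four weights occur. -/

section fullSupport
variable {k : Type*} [Field k] [NeZero (2 : k)] {A : Type*} [Ring A] [Algebra k A]
  {ρ : LeftCoaction k (KP k) A}

variable {τ : A →ₗ[k] k} {a b : A}

theorem betax_eq (hρ : ρ.IsAMExact) (hτ : τ 1 = 1) (ha : ρ.IsWeight (x k) a) (haa : a * a = 1)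
    {v w : A × A} (hv : v ∈ pairs ρ) (hw : w ∈ pairs ρ) :
    betax k v w = form k τ (leftX k a v) w • a := by
  have h := beta1_eq hρ hτ (leftX_mem ha hv) hw
  rw [beta1_leftX] at h
  rw [← one_mul (betax k v w), ← haa, mul_assoc, h, mul_smul_comm, mul_one]

theorem betay_eq (hρ : ρ.IsAMExact) (hτ : τ 1 = 1) (hb : ρ.IsWeight (y k) b) (hbb : b * b = 1)
    {v w : A × A} (hv : v ∈ pairs ρ) (hw : w ∈ pairs ρ) :
    betay k v w = form k τ (leftY k b v) w • b := by
  have h := beta1_eq hρ hτ (leftY_mem hb hv) hw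
  rw [beta1_leftY] at h
  rw [← one_mul (betay k v w), ← hbb, mul_assoc, h, mul_smul_comm, mul_one]

theorem betaxy_eq (hρ : ρ.IsAMExact) (hτ : τ 1 = 1) (ha : ρ.IsWeight (x k) a) (haa : a * a = 1)
    (hb : ρ.IsWeight (y k) b) (hbb : b * b = 1)
    {v w : A × A} (hv : v ∈ pairs ρ) (hw : w ∈ pairs ρ) :
    betaxy k v w = form k τ (leftX k a (leftY k b v)) w • (b * a) := by
  have h := beta1_eq hρ hτ (leftX_mem ha (leftY_mem hb hv)) hw
  have e : leftX k a (leftY k b v) = leftXY k (a * b) v := by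
    ext <;> simp [leftX_apply, leftY_apply, leftXY_apply, mul_assoc]
  -- The unit of weight xy used here is `a * b`, whose inverse is `b * a`; this avoids assuming that
  -- a and b commute.
  have e1 : b * a * (a * b) = 1 := by
    rw [mul_assoc, ← mul_assoc a, haa, one_mul, hbb]
  rw [e, beta1_leftXY] at h
  rw [e, ← one_mul (betaxy k v w), ← e1, mul_assoc (b * a), h, mul_smul_comm, mul_one]

/-- The associativity constraint on the form. -/
theorem form_assoc (hρ : ρ.IsAMExact) (hτ : τ 1 = 1) (ha : ρ.IsWeight (x k) a) (haa : a * a = 1)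
    (hb : ρ.IsWeight (y k) b) (hbb : b * b = 1)
    {v w u : A × A} (hv : v ∈ pairs ρ) (hw : w ∈ pairs ρ) (hu : u ∈ pairs ρ) :
    form k τ w u • v + form k τ (leftX k a w) u • rightX k a v =
      form k τ v w • u + form k τ (leftY k b v) w • leftY k b u := by
  have e : v.1 * (w.1 * u.1) = v.1 * w.1 * u.1 := (mul_assoc _ _ _).symm
  rw [fst_mul_fst (k := k) v w, fst_mul_fst (k := k) w u, beta1_eq hρ hτ hv hw,
    beta1_eq hρ hτ hw hu, betax_eq hρ hτ ha haa hv hw, betax_eq hρ hτ ha haa hw hu,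
    betay_eq hρ hτ hb hbb hv hw, betay_eq hρ hτ hb hbb hw hu,
    betaxy_eq hρ hτ ha haa hb hbb hv hw, betaxy_eq hρ hτ ha haa hb hbb hw hu] at e
  -- Expanding both sides of `e`, the weights 1 and x on the right of `v.1`, and 1 and y on the left
  -- of `u.1`, give first entries of pairs. The remaining terms are second entries, collected in `w`
  -- and `w'` and then discarded.
  refine (pairs_inj
    (w := form k τ (leftY k b w) u • rightY k b v -
      form k τ (leftX k a (leftY k b w)) u • rightX k a (rightY k b v))
    (w' := form k τ (leftX k a v) w • leftX k a u -
      form k τ (leftX k a (leftY k b v)) w • leftY k b (leftX k a u))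
    (add_mem (Submodule.smul_mem _ _ hv) (Submodule.smul_mem _ _ (rightX_mem ha hv)))
    (sub_mem (Submodule.smul_mem _ _ (rightY_mem hb hv))
      (Submodule.smul_mem _ _ (rightX_mem ha (rightY_mem hb hv))))
    (add_mem (Submodule.smul_mem _ _ hu) (Submodule.smul_mem _ _ (leftY_mem hb hu)))
    (sub_mem (Submodule.smul_mem _ _ (leftX_mem ha hu))
      (Submodule.smul_mem _ _ (leftY_mem hb (leftX_mem ha hu)))) ?_).1
  simp only [mul_add, add_mul, mul_smul_comm, smul_mul_assoc, mul_one, one_mul] at e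
  generalize form k τ v w = f1 at *
  generalize form k τ w u = f2 at *
  generalize form k τ (leftX k a v) w = f3 at *
  generalize form k τ (leftX k a w) u = f4 at *
  generalize form k τ (leftY k b v) w = f5 at *
  generalize form k τ (leftY k b w) u = f6 at *
  generalize form k τ (leftX k a (leftY k b v)) w = f7 at *
  generalize form k τ (leftX k a (leftY k b w)) u = f8 at *
  simp only [leftX_apply, leftY_apply, rightX_apply, rightY_apply, Prod.fst_add, Prod.snd_sub,
    Prod.smul_fst, Prod.smul_snd, ← mul_assoc, smul_neg, sub_neg_eq_add] at e ⊢
  rw [← add_assoc, ← add_assoc, e]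
  abel

/-- Anticommuting units act by commuting operators, the case in which the associativity constraint
has no room for a nonzero pair. -/
theorem pairs_eq_zero_of_anticomm (hρ : ρ.IsAMExact) (ha : ρ.IsWeight (x k) a) (haa : a * a = 1)
    (hb : ρ.IsWeight (y k) b) (hbb : b * b = 1) (hab : a * b = -(b * a)) :
    ∀ v ∈ pairs ρ, v = 0 := by
  obtain ⟨τ, hτ⟩ := exists_normalizing_functional hρ
  exact eq_zero_of_commuting_involutions (X := leftX k a) (Y := leftY k b) (X' := rightX k a)
    (b := form k τ) (fun v hv => leftX_mem ha hv) (fun v hv => leftY_mem hb hv)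
    (leftX_leftX haa) (leftY_leftY hbb) (rightX_rightX haa) (leftX_leftY_of_anticomm hab)
    (leftX_rightX a a) (fun v hv h0 => form_nondegenerate hρ hτ hv h0)
    (fun v hv w hw u hu => form_assoc hρ hτ ha haa hb hbb hv hw hu)

theorem exists_character_of_comm_units [IsAlgClosed k] (hρ : ρ.IsAMExact)
    (ha : ρ.IsWeight (x k) a) (haa : a * a = 1) (hb : ρ.IsWeight (y k) b) (hbb : b * b = 1)
    (hx : ∀ c, ρ.IsWeight (x k) c → ∃ r : k, c = r • a)
    (hy : ∀ c, ρ.IsWeight (y k) c → ∃ r : k, c = r • b)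
    (hxy : ∀ c, ρ.IsWeight (x k * y k) c → ∃ r : k, c = r • (a * b))
    (hab : a * b = b * a) : Nonempty (A →ₐ[k] k) := by
  have := hρ.isRightSimple.nontrivial
  obtain ⟨τ, hτ⟩ := exists_normalizing_functional hρ
  obtain ⟨α, hα, hT⟩ := exists_sign_of_anticommuting_involutions (T := pairs ρ)
    (X := leftX k a) (Y := leftY k b) (X' := rightX k a) (Y' := rightY k b) (b := form k τ)
    (fun v hv => leftX_mem ha hv) (fun v hv => leftY_mem hb hv)
    (fun v hv => rightX_mem ha hv) (fun v hv => rightY_mem hb hv)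
    (leftX_leftX haa) (leftY_leftY hbb) (rightX_rightX haa) (leftX_leftY_of_comm hab)
    (leftX_rightX a a) (leftY_rightY b b) (leftX_rightY a b) (leftY_rightX b a)
    (fun v hv h0 => form_nondegenerate hρ hτ hv h0)
    (fun v hv w hw => by rw [form_apply, form_apply, beta1_balanced_x])
    (fun v hv w hw => by
      rw [form_apply, form_apply, beta1_leftY, beta1_rightY]
      obtain ⟨r, hr⟩ := hy _ (isWeight_beta hv hw).2.2.1
      rw [hr, mul_smul_comm, smul_mul_assoc])
    (fun v hv w hw u hu => form_assoc hρ hτ ha haa hb hbb hv hw hu)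
  -- This is `(1 + a) (1 + α b)`, the unnormalized projector to the character `a ↦ 1`, `b ↦ α`.
  -- Moving an entry of a pair past it exchanges `a` and `α b`, which preserves the product, so `f`
  -- is central.
  let f : A := 1 + (a + α • b + α • (a * b))
  have hf : f ≠ 0 := one_add_ne_zero (ρ := ρ) (add_mem (add_mem (mem_noninvariant_x ha)
    (Submodule.smul_mem _ _ (mem_noninvariant_y hb)))
    (Submodule.smul_mem _ _ (mem_noninvariant_xy (ha.mul hb))))
  have haab : a * (a * b) = b := by rw [← mul_assoc, haa, one_mul]
  have hbab : b * (a * b) = a := by rw [hab, ← mul_assoc, hbb, one_mul]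
  have haf : a * f = f := by
    simp only [f, mul_add, mul_smul_comm, haa, haab, mul_one]; abel
  have hbf : b * f = α • f := by
    simp only [f, mul_add, mul_smul_comm, hbb, hbab, ← hab, mul_one, smul_add, smul_smul, hα,
      one_smul]
    abel
  have hfa : f * a = a * f := by
    simp only [f, mul_add, add_mul, mul_smul_comm, smul_mul_assoc, mul_one, one_mul, ← hab,
      mul_assoc]
  have hfb : f * b = b * f := by
    simp only [f, mul_add, add_mul, mul_smul_comm, smul_mul_assoc, mul_one, one_mul, hab,
      mul_assoc]
  have hpair : ∀ v ∈ pairs ρ, (v.1 * a = α • (b * v.1) ∧ v.2 * a = α • (b * v.2)) ∧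
      v.1 * b = α • (a * v.1) ∧ v.2 * b = α • (a * v.2) := by
    intro v hv
    obtain ⟨h1, h2⟩ := hT v hv
    rw [rightX_apply, leftY_apply, Prod.smul_mk, Prod.mk.injEq, smul_neg, neg_inj] at h1
    rw [rightY_apply, leftX_apply, Prod.smul_mk, Prod.mk.injEq] at h2
    exact ⟨h1, h2.2, h2.1⟩
  have hcomm : ∀ c : A, c * a = α • (b * c) → c * b = α • (a * c) → c * f = f * c := by
    intro c h1 h2
    have h3 : c * (a * b) = a * b * c := by
      rw [← mul_assoc, h1, smul_mul_assoc, mul_assoc, h2, mul_smul_comm, smul_smul, hα, one_smul,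
        ← mul_assoc, hab]
    simp only [f, mul_add, add_mul, mul_smul_comm, smul_mul_assoc, h1, h2, h3, smul_smul, hα,
      one_smul, mul_one, one_mul]
    abel
  refine exists_character_of_weights hρ hf
    (central_of_components hρ (fun c hc => ?_) (fun c hc => ?_) (fun c hc => ?_)
      (fun v hv => ?_)) (fun c hc => ?_) (fun c hc => ?_) (fun c hc => ?_)
  · obtain ⟨r, rfl⟩ := hx c hc
    rw [smul_mul_assoc, mul_smul_comm, hfa]
  · obtain ⟨r, rfl⟩ := hy c hc
    rw [smul_mul_assoc, mul_smul_comm, hfb]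
  · obtain ⟨r, rfl⟩ := hxy c hc
    rw [smul_mul_assoc, mul_smul_comm, ← mul_assoc f, hfa, mul_assoc, mul_assoc, hfb]
  · obtain ⟨⟨h1, h2⟩, h3, h4⟩ := hpair v hv
    exact ⟨hcomm _ h1 h3, hcomm _ h2 h4⟩
  · obtain ⟨r, rfl⟩ := hx c hc
    exact ⟨r, by rw [smul_mul_assoc, haf]⟩
  · obtain ⟨r, rfl⟩ := hy c hc
    exact ⟨r * α, by rw [smul_mul_assoc, hbf, smul_smul]⟩
  · obtain ⟨r, rfl⟩ := hxy c hc
    exact ⟨r * α, by rw [smul_mul_assoc, mul_assoc, hbf, mul_smul_comm, haf, smul_smul]⟩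

section twisted

theorem map_monomial (ha : ρ.IsWeight (x k) a) (hb : ρ.IsWeight (y k) b) (g : Klein) :
    ρ.toAlgHom (monomial a b g) = ofKlein k g ⊗ₜ monomial a b g := by
  have : ofKlein k g = x k ^ (g.1.toAdd.val) * y k ^ (g.2.toAdd.val) := by
    change incl (MonoidAlgebra.of k Klein g) = _
    rw [KleinAlg.of_eq, map_mul, map_pow, map_pow]; rfl
  rw [this, monomial, map_mul, map_pow, map_pow, ha, hb]
  simp

theorem map_twistedHom (ha : ρ.IsWeight (x k) a) (hb : ρ.IsWeight (y k) b)
    (haa : a * a = 1) (hbb : b * b = 1) (hab : a * b = -(b * a))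
    (p : TwistedGroupAlgebra (Klein.cocycle k)) :
    ρ.toAlgHom (twistedHom k haa hbb hab p) =
      Algebra.TensorProduct.map (AlgHom.id k (KP k)) (twistedHom k haa hbb hab)
        ((twistedCoaction k).toAlgHom p) := by
  induction p using TwistedGroupAlgebra.induction_on with
  | h0 => simp
  | hadd p q hp hq => simp only [map_add, hp, hq]
  | he r g =>
    have : (twistedCoaction k).toAlgHom (TwistedGroupAlgebra.e _ g) =
        ofKlein k g ⊗ₜ TwistedGroupAlgebra.e _ g := TwistedGroupAlgebra.coactionHom_e _ g
    simp only [map_smul, twistedHom_e, map_monomial ha hb, this, Algebra.TensorProduct.map_tmul,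
      AlgHom.id_apply]

/-- Without pairs, `A` is the sum of its four weight lines, spanned by the monomials. -/
theorem twistedHom_bijective (hρ : ρ.IsAMExact) (hp : ∀ v ∈ pairs ρ, v = 0)
    (ha : ρ.IsWeight (x k) a) (haa : a * a = 1) (hb : ρ.IsWeight (y k) b) (hbb : b * b = 1)
    (hx : ∀ c, ρ.IsWeight (x k) c → ∃ r : k, c = r • a)
    (hy : ∀ c, ρ.IsWeight (y k) c → ∃ r : k, c = r • b)
    (hxy : ∀ c, ρ.IsWeight (x k * y k) c → ∃ r : k, c = r • (a * b))
    (hab : a * b = -(b * a)) : Function.Bijective (twistedHom k haa hbb hab) := by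
  have := hρ.isRightSimple.nontrivial
  have m1 : monomial a b 1 = 1 := by simp [monomial]
  have mx : monomial a b Klein.x = a := by simp [monomial, Klein.x, ZMod.val_one]
  have my : monomial a b Klein.y = b := by simp [monomial, Klein.y, ZMod.val_one]
  have mxy : monomial a b (Klein.x * Klein.y) = a * b := by
    simp [monomial, Klein.x, Klein.y, ZMod.val_one]
  have ha0 : a ≠ 0 := by rintro rfl; simp at haa
  have hb0 : b ≠ 0 := by rintro rfl; simp at hbb
  have hab0 : a * b ≠ 0 := by
    intro h
    apply hb0
    rw [← one_mul b, ← haa, mul_assoc, h, mul_zero]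
  constructor
  · rw [injective_iff_map_eq_zero]
    intro p hp0
    have huniv : (Finset.univ : Finset Klein) = {1, Klein.x, Klein.y, Klein.x * Klein.y} := by
      decide
    have e : twistedHom k haa hbb hab p = p.coeff 1 • 1 + p.coeff Klein.x • a +
        p.coeff Klein.y • b + p.coeff (Klein.x * Klein.y) • (a * b) := by
      change Finsupp.linearCombination k (monomial a b) p.coeff = _
      rw [Finsupp.linearCombination_apply, Finsupp.sum_fintype _ _ (by simp), huniv,
        Finset.sum_insert (by decide), Finset.sum_insert (by decide),
        Finset.sum_insert (by decide), Finset.sum_singleton, m1, mx, my, mxy]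
      abel
    rw [hp0] at e
    obtain ⟨i1, i2, i3, i4, -⟩ := components_eq_zero (isWeight_one.smul _) (ha.smul _)
      (hb.smul _) ((ha.mul hb).smul _) (zero_mem (pairs ρ)) (zero_mem (pairs ρ))
      (by simpa using e.symm)
    apply TwistedGroupAlgebra.ext
    ext g
    have hg : g ∈ (Finset.univ : Finset Klein) := Finset.mem_univ g
    rw [huniv] at hg
    simp only [Finset.mem_insert, Finset.mem_singleton] at hg
    rcases hg with rfl | rfl | rfl | rfl
    · exact (smul_eq_zero.1 i1).resolve_right one_ne_zero
    · exact (smul_eq_zero.1 i2).resolve_right ha0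
    · exact (smul_eq_zero.1 i3).resolve_right hb0
    · exact (smul_eq_zero.1 i4).resolve_right hab0
  · intro c
    obtain ⟨p1, px, py, pxy, v, w, h1, ix, iy, ixy, iv, iw, rfl⟩ := exists_components ρ c
    obtain ⟨r, rfl⟩ := hρ.exists_eq_smul_one h1
    obtain ⟨s, rfl⟩ := hx _ ix
    obtain ⟨t, rfl⟩ := hy _ iy
    obtain ⟨u, rfl⟩ := hxy _ ixy
    refine ⟨r • TwistedGroupAlgebra.e _ 1 + s • TwistedGroupAlgebra.e _ Klein.x +
      t • TwistedGroupAlgebra.e _ Klein.y + u • TwistedGroupAlgebra.e _ (Klein.x * Klein.y), ?_⟩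
    simp only [map_add, map_smul, twistedHom_e, m1, mx, my, mxy, hp v iv, hp w iw, Prod.fst_zero,
      Prod.snd_zero, add_zero]

theorem exists_iso_twisted (hρ : ρ.IsAMExact)
    (ha : ρ.IsWeight (x k) a) (haa : a * a = 1) (hb : ρ.IsWeight (y k) b) (hbb : b * b = 1)
    (hx : ∀ c, ρ.IsWeight (x k) c → ∃ r : k, c = r • a)
    (hy : ∀ c, ρ.IsWeight (y k) c → ∃ r : k, c = r • b)
    (hxy : ∀ c, ρ.IsWeight (x k * y k) c → ∃ r : k, c = r • (a * b))
    (hab : a * b = -(b * a)) : Nonempty (ρ.Iso (twistedCoaction k)) := by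
  let e := AlgEquiv.ofBijective (twistedHom k haa hbb hab) (twistedHom_bijective hρ
    (pairs_eq_zero_of_anticomm hρ ha haa hb hbb hab) ha haa hb hbb hx hy hxy hab)
  refine ⟨⟨e.symm, fun c => ?_⟩⟩
  obtain ⟨p, rfl⟩ := e.surjective c
  have h : ρ.toAlgHom (e p) = Algebra.TensorProduct.map (AlgHom.id k (KP k)) (e : _ →ₐ[k] A)
    ((twistedCoaction k).toAlgHom p) := map_twistedHom ha hb haa hbb hab p
  rw [h, e.symm_apply_apply]
  generalize (twistedCoaction k).toAlgHom p = t
  induction t using TensorProduct.induction_on with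
  | zero => simp
  | tmul h q => simp
  | add u v hu hv => rw [map_add, map_add, ← hu, ← hv]

end twisted
end fullSupport
end KP

/-! ### Case analysis on the support and the conclusion. -/

namespace KP
open LeftCoaction

/-- Normalized semi-invariants are units, so the weights that occur are closed under products and
two of x, y, xy force the third. The cases are thus the subgroups of `K`, with the full group split
by the sign in `a * b = ± b * a`. -/
theorem exists_character_or_iso_twisted {k : Type*} [Field k] [IsAlgClosed k] [NeZero (2 : k)]
    {A : Type*} [Ring A] [Algebra k A] {ρ : LeftCoaction k (KP k) A} (hρ : ρ.IsAMExact) :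
    Nonempty (A →ₐ[k] k) ∨ Nonempty (ρ.Iso (twistedCoaction k)) := by

  have hxxy : x k * (x k * y k) = y k := x_mul_x_mul k _
  have hyxy : y k * (x k * y k) = x k := by rw [y_mul_x_mul, y_mul_y, mul_one]
  have hxyxy : x k * y k * (x k * y k) = 1 := by rw [mul_assoc, hyxy, x_mul_x]
  have dich : ∀ g : KP k, g * g = 1 → (∀ c, ρ.IsWeight g c → c = 0) ∨
      ∃ u, ρ.IsWeight g u ∧ u * u = 1 ∧ ∀ c, ρ.IsWeight g c → ∃ r : k, c = r • u := by
    intro g hg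
    by_cases h : ∀ c, ρ.IsWeight g c → c = 0
    · exact Or.inl h
    · push Not at h
      obtain ⟨c, hc, h0⟩ := h
      exact Or.inr (hρ.exists_normalized hg hc h0)
  have hdiag : ∀ u : A, u * u = 1 → ∀ c, (∃ r : k, c = r • u) →
      ∃ r : k, c * (1 + u) = r • (1 + u) ∧ c * u = u * c := by
    rintro u hu _ ⟨r, rfl⟩
    refine ⟨r, ?_, by simp⟩
    rw [mul_add, mul_one, smul_mul_assoc, hu, ← smul_add, add_comm]
  have hzero : ∀ u c : A, c = 0 → ∃ r : k, c * (1 + u) = r • (1 + u) ∧ c * u = u * c := by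
    rintro u _ rfl
    exact ⟨0, by simp, by simp⟩
  rcases dich (x k) x_mul_x with hx | ⟨a, ha, haa, hx⟩ <;>
    rcases dich (y k) y_mul_y with hy | ⟨b, hb, hbb, hy⟩
  · rcases dich (x k * y k) hxyxy with hxy | ⟨c, hc, hcc, hxy⟩
    · exact Or.inl (exists_character_of_pairs_eq_zero hρ (pairs_eq_zero_of_y hρ hy hxy)
        (zero_mem _) (fun c hc => hzero 0 c (hx c hc)) (fun c hc => hzero 0 c (hy c hc)) hxy)
    · exact Or.inl (exists_character_of_xy hρ hx hy hc hcc hxy)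
  · have hxy : ∀ c, ρ.IsWeight (x k * y k) c → c = 0 := by
      intro c hc
      have h := hx (b * c) (hyxy ▸ hb.mul hc)
      rw [← one_mul c, ← hbb, mul_assoc, h, mul_zero]
    exact Or.inl (exists_character_of_pairs_eq_zero hρ (pairs_eq_zero_of_x hρ hx hxy)
      (mem_noninvariant_y hb) (fun c hc => hzero b c (hx c hc))
      (fun c hc => hdiag b hbb c (hy c hc)) hxy)
  · have hxy : ∀ c, ρ.IsWeight (x k * y k) c → c = 0 := by
      intro c hc
      have h := hy (a * c) (hxxy ▸ ha.mul hc)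
      rw [← one_mul c, ← haa, mul_assoc, h, mul_zero]
    exact Or.inl (exists_character_of_pairs_eq_zero hρ (pairs_eq_zero_of_y hρ hy hxy)
      (mem_noninvariant_x ha) (fun c hc => hdiag a haa c (hx c hc))
      (fun c hc => hzero a c (hy c hc)) hxy)
  · have hxy : ∀ c, ρ.IsWeight (x k * y k) c → ∃ r : k, c = r • (a * b) := by
      intro c hc
      obtain ⟨r, hr⟩ := hy (a * c) (hxxy ▸ ha.mul hc)
      exact ⟨r, by rw [← one_mul c, ← haa, mul_assoc, hr, mul_smul_comm]⟩
    have := hρ.isRightSimple.nontrivial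
    obtain ⟨c, hc⟩ := hxy (b * a) (by rw [x_mul_y]; exact hb.mul ha)
    have hb0 : b ≠ 0 := by rintro rfl; simp at hbb
    -- Moving `b` past `a` twice multiplies it by `c * c`, while `a * a = 1`; hence `c = ± 1`.
    have hcc : (c * c - 1) • b = 0 := by
      have e1 : b * a * a = b := by rw [mul_assoc, haa, mul_one]
      have e2 : b * a * a = (c * c) • b := by
        rw [hc, smul_mul_assoc, mul_assoc, hc, mul_smul_comm, ← mul_assoc, haa, one_mul, smul_smul]
      rw [sub_smul, ← e2, e1, one_smul, sub_self]
    have hsq := (smul_eq_zero.1 hcc).resolve_right hb0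
    have hfac : (c - 1) * (c + 1) = 0 := by linear_combination hsq
    rcases mul_eq_zero.1 hfac with h | h
    · rw [sub_eq_zero.1 h, one_smul] at hc
      exact Or.inl (exists_character_of_comm_units hρ ha haa hb hbb hx hy hxy hc.symm)
    · rw [eq_neg_of_add_eq_zero_left h, neg_smul, one_smul] at hc
      exact Or.inr (exists_iso_twisted hρ ha haa hb hbb hx hy hxy (by rw [hc, neg_neg]))

end KP

theorem mainTheorem2 {k : Type*} [Field k] [IsAlgClosed k] [NeZero (2 : k)]
    {A : Type*} [Ring A] [Algebra k A] (ρ : LeftCoaction k (KP k) A) (hρ : ρ.IsAMExact) :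
    (∃ B : CoidealSubalgebra k (KP k), Nonempty (ρ.Iso B.coaction)) ∨
      Nonempty (ρ.Iso (KP.twistedCoaction k)) := by
  rcases KP.exists_character_or_iso_twisted hρ with ⟨⟨χ⟩⟩ | h
  · exact Or.inl (hρ.isRightSimple.exists_coidealSubalgebra χ)
  · exact Or.inr h
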